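/- Let $N\subseteq\mathbb R\setminus\{0,1\}$ be a nonempty set of exponents (the whole class is the case $N=\mathbb R\setminus\{0,1\}$). Consider the class of equations $$u_t+a(u^n)_x=g(t)\,u_{xx},$$ whose arbitrary elements are a constant $a\neq0$, an exponent $n\in N$ and a smooth nonvanishing function $g$ of $t$. Real powers $u^n$ are used where they are defined and smooth: for $u>0$; also for $u<0$ if $n$ is an integer; and at $u=0$ if $n$ is a nonnegative integer. Let $\Omega$ be a nonempty connected open set of points $(t,x,u)$ at which $u^n$ is so defined for every $n\in N$. A usual equivalence transformation of the class over $\Omega$ is a smooth map $(t,x,u,a,n,g)\mapsto(\tilde t,\tilde x,\tilde u,\tilde a,\tilde n,\tilde g)$, defined for $(t,x,u)\in\Omega$, $a\ne0$, $n\in N$, $g\neq0$, with a smooth inverse on its image, such that 1. $(\tilde t,\tilde x,\tilde u)=\varphi(t,x,u)$ does not involve $a,n,g$, where $\varphi$ is smooth with a smooth inverse on its image and $\tilde u^{\,n}$ is defined in the above sense for every $n\in N$; 2. every equation of the class is mapped to an equation of the class: for all $a\ne0$, $n\in N$ and every smooth nonvanishing function $g$ on the projection of $\Omega$ to the $t$-axis,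 the values of $\tilde a,\tilde n,\tilde g$ along $\Omega$ are those of a constant $\tilde a\neq0$, a constant $\tilde n\in N$ and a smooth nonvanishing function $\tilde g(\tilde t)$ on the projection of $\varphi(\Omega)$ to the $\tilde t$-axis, and the prolongation of $\varphi$ to second-order jets takes the jets satisfying the equation with $(a,n,g)$, and only those, to jets satisfying the equation with $(\tilde a,\tilde n,\tilde g)$. **Theorem.** The usual equivalence transformations of the class over $\Omega$ (that is, the elements of the usual equivalence group $G^\sim$) are exactly the maps $$\tilde t=\delta_1t+\delta_2,\quad \tilde x=\delta_3x+\delta_4,\quad \tilde u=\delta_5u,\quad \tilde a=\frac{\delta_3}{\delta_1}\,\delta_5^{\,1-n}a,\quad \tilde g=\frac{\delta_3^2}{\delta_1}\,g,\quad \tilde n=n,$$ where $\delta_1,\dots,\delta_5$ are real constants with $\delta_1\delta_3\delta_5\neq0$; here $\delta_5>0$ if $N$ contains a non-integer exponent (so that $\delta_5^{1-n}$ and $\tilde u^{\,n}$ are real), while the sign of $\delta_5$ is arbitrary if all exponents in $N$ are integers. -/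

import Mathlib

open Set Filter Topology
open scoped ContDiff

namespace GenBurgers

/-- The space of the variables `(t, x, u)`. -/
abbrev Var := ℝ × ℝ × ℝ

/-- The space of the values `(a, n, g)` of the arbitrary elements. -/
abbrev Elt := ℝ × ℝ × ℝ

/-- `s ↦ s ^ n` is a well-defined smooth real function near `s = u`: either `u > 0`, or `u < 0` and
`n` is an integer, or `u = 0` and `n` is a nonnegative integer. -/
def PowDefined (n u : ℝ) : Prop :=
  0 < u ∨ (u < 0 ∧ ∃ k : ℤ, n = k) ∨ (u = 0 ∧ ∃ k : ℕ, n = k)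

/-- The points `(t, x, u)` at which every equation with an exponent from `N` makes sense. -/
def varDomain (N : Set ℝ) : Set Var := {z | ∀ n ∈ N, PowDefined n z.2.2}

/-- The admissible values `(a, n, g)` of the arbitrary elements: `a ≠ 0`, `n ∈ N`, `g ≠ 0`. -/
def eltDomain (N : Set ℝ) : Set Elt := {e | e.1 ≠ 0 ∧ e.2.1 ∈ N ∧ e.2.2 ≠ 0}

/-- The set of values of `t` on a set of points `(t, x, u)`. -/
def times (Ω : Set Var) : Set ℝ := Prod.fst '' Ω

/-- `(a, n, g)` are the arbitrary elements of an equation `u_t + a (u ^ n)_x = g(t) u_xx` of the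
class with exponents in `N`, for `t` in `I`: the constant `a` is nonzero, and `g` is smooth and
nonvanishing on `I`. -/
structure InClass (N I : Set ℝ) (a n : ℝ) (g : ℝ → ℝ) : Prop where
  a_ne_zero : a ≠ 0
  n_mem : n ∈ N
  g_smooth : ContDiffOn ℝ ∞ g I
  g_ne_zero : ∀ t ∈ I, g t ≠ 0

/-- The function `u = f(t, x)` satisfies `u_t + a (u ^ n)_x = g(t) u_xx` at the point `p = (t, x)`;
that is, the second-order jet of `f` at `p` lies on the manifold that the equation determines in the
second-order jet space. -/
def SatisfiesAt (a n : ℝ) (g : ℝ → ℝ) (f : ℝ × ℝ → ℝ) (p : ℝ × ℝ) : Prop :=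
  deriv (fun t => f (t, p.2)) p.1 + a * deriv (fun x => f (p.1, x) ^ n) p.2
    = g p.1 * iteratedDeriv 2 (fun x => f (p.1, x)) p.2

/-- The point `(t̃, x̃)` over which `φ` puts the point `(t, x, f(t, x))` of the graph of `f`. -/
def basePoint (φ : Var → Var) (f : ℝ × ℝ → ℝ) (p : ℝ × ℝ) : ℝ × ℝ :=
  ((φ (p.1, p.2, f p)).1, (φ (p.1, p.2, f p)).2.1)

/-- Near `p`, the map `φ` carries the graph of `f` into the graph of `f'`. -/
def CarriesGraph (φ : Var → Var) (f f' : ℝ × ℝ → ℝ) (p : ℝ × ℝ) : Prop :=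
  ∀ᶠ q in 𝓝 p, f' (basePoint φ f q) = (φ (q.1, q.2, f q)).2.2

/-- The point transformation `φ` of `Ω` maps the equation with arbitrary elements `(a, n, g)` to the
equation with arbitrary elements `(a', n', g')`: its prolongation to the second-order jet space
(the map from the jet of `f` to the jet of the function `f'` whose graph is the image of the graph
of `f`) takes jets on the manifold of the first equation, and only those, to jets on the manifold
of the second. For a diffeomorphism `φ`, the function `f'` exists exactly when the image of the
graph of `f` is not vertical at the point, and its jet is then unique. -/
def MapsEquation (Ω : Set Var) (φ : Var → Var)
    (a n : ℝ) (g : ℝ → ℝ) (a' n' : ℝ) (g' : ℝ → ℝ) : Prop :=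
  ∀ (f f' : ℝ × ℝ → ℝ) (p : ℝ × ℝ), (p.1, p.2, f p) ∈ Ω →
    ContDiffAt ℝ ∞ f p → ContDiffAt ℝ ∞ f' (basePoint φ f p) → CarriesGraph φ f f' p →
      (SatisfiesAt a n g f p ↔ SatisfiesAt a' n' g' f' (basePoint φ f p))

/-- `F` is smooth on `S` and has a smooth inverse on the image of `S`. -/
def IsDiffeoOn {E : Type*} [NormedAddCommGroup E] [NormedSpace ℝ E] (F : E → E) (S : Set E) :
    Prop :=
  ContDiffOn ℝ ∞ F S ∧ ∃ H : E → E, ContDiffOn ℝ ∞ H (F '' S) ∧ LeftInvOn H F S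

/-- `Φ`, acting on the extended space of all `(t, x, u, a, n, g)` with `(t, x, u)` in `Ω` and
admissible `(a, n, g)`, is a usual equivalence transformation of the class
`u_t + a (u ^ n)_x = g(t) u_xx` with exponents `n ∈ N`: it is a nondegenerate point transformation
of the extended space, its `(t, x, u)`-components are a nondegenerate point transformation `φ` that
does not involve the arbitrary elements, and it maps every equation of the class to an equation of
the class. -/
def IsUsualEquivalence (N : Set ℝ) (Ω : Set Var) (Φ : Var × Elt → Var × Elt) : Prop :=
  IsDiffeoOn Φ (Ω ×ˢ eltDomain N) ∧
  ∃ φ : Var → Var,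
    IsDiffeoOn φ Ω ∧ MapsTo φ Ω (varDomain N) ∧
    (∀ z ∈ Ω, ∀ e ∈ eltDomain N, (Φ (z, e)).1 = φ z) ∧
    ∀ (a n : ℝ) (g : ℝ → ℝ), InClass N (times Ω) a n g →
      ∃ (a' n' : ℝ) (g' : ℝ → ℝ), InClass N (times (φ '' Ω)) a' n' g' ∧
        (∀ z ∈ Ω, (Φ (z, (a, n, g z.1))).2 = (a', n', g' (φ z).1)) ∧
        MapsEquation Ω φ a n g a' n' g'

end GenBurgers

namespace GenBurgers

/-! Write the point transformation as `(T, X, U)`. Feeding quadratic polynomials into the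
requirement that jets on one equation go to jets on the other turns it into algebraic relations
between the derivatives of `T`, `X`, `U` at each point. Constant coefficients `g` already suffice to
determine the transformation.

The derivative `u_tt` is absent from the equation, so varying it alone must not change the
transformed `u_xx`. This forces `T` to depend on `t` only (`total_deriv_T_eq_zero`,
`fderiv_T_eq_zero`). Varying `u_xx` together with `u_t` gives `g (X_x + q X_u)² = g' T_t` for every
slope `q` with `X_x + q X_u ≠ 0`, hence `X_u = 0` and the formula for `g'`. What remains is a
quadratic polynomial in `q = u_x` (`determining_identity`). Its coefficients give `U_uu = 0` and two
further relations (`determining_equations`).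

The same transformation serves all `a` and `g`, so comparing different values of them splits these
relations further: `U_x = 0`, then `U_t = 0`. The last relation becomes `α (c + m u)^(n'-1) = β
u^(n-1) + S` along the `u`-axis. It forces `n' = n`, and `c = S = 0` unless `n = 2`
(`power_eq_power`). For `n = 2`, the case with Galilean boosts and shifts of `u`, comparing `a = 1`
with `a = 2` removes `c`. In both cases comparing `g = 1` with `g = 2` then gives `X_t = X_xx = 0`
(`scaling_form`). Finally `T_t` is constant because `a'` is, and connectedness of `Ω` makes the
constants global (`exists_scaling_form`).

Conversely, under a scaling the two sides of the equation change by a common constant factor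
(`mapsEquation_scaling`). -/

/-! ### Chain rules along curves, local inversion and derivatives of powers. -/

theorem hasDerivAt_fderiv_comp {E : Type*} [NormedAddCommGroup E] [NormedSpace ℝ E]
    {W : E → ℝ} {γ : ℝ → E} {s : ℝ} (hW : ContDiffAt ℝ ∞ W (γ s)) (hγ : ContDiffAt ℝ ∞ γ s) :
    HasDerivAt (fun r => fderiv ℝ W (γ r) (deriv γ r))
      (fderiv ℝ (fderiv ℝ W) (γ s) (deriv γ s) (deriv γ s) +
        fderiv ℝ W (γ s) (deriv (deriv γ) s)) s := by
  have h1 : HasDerivAt γ (deriv γ s) s := (hγ.differentiableAt (by simp)).hasDerivAt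
  have h2 : HasDerivAt (deriv γ) (deriv (deriv γ) s) s := by
    have : ContDiffAt ℝ ∞ (deriv γ) s := by
      have := (hγ.fderiv_right (m := ∞) (by simp)).clm_apply (contDiffAt_const (c := (1 : ℝ)))
      exact this
    exact (this.differentiableAt (by simp)).hasDerivAt
  have h3 : HasFDerivAt (fderiv ℝ W) (fderiv ℝ (fderiv ℝ W) (γ s)) (γ s) :=
    ((hW.fderiv_right (m := ∞) (by simp)).differentiableAt (by simp)).hasFDerivAt
  exact (h3.comp_hasDerivAt s h1).clm_apply h2

theorem deriv_comp_eventuallyEq {E : Type*} [NormedAddCommGroup E] [NormedSpace ℝ E]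
    {W : E → ℝ} {γ : ℝ → E} {s : ℝ} (hW : ContDiffAt ℝ ∞ W (γ s)) (hγ : ContDiffAt ℝ ∞ γ s) :
    deriv (fun r => W (γ r)) =ᶠ[𝓝 s] fun r => fderiv ℝ W (γ r) (deriv γ r) := by
  -- Order `∞` at a point need not hold on a neighbourhood, whereas a finite order does; order `1`
  -- is enough here.
  have e1 : ∀ᶠ r in 𝓝 s, ContDiffAt ℝ 1 W (γ r) :=
    hγ.continuousAt.eventually ((hW.of_le (by exact_mod_cast le_top)).eventually (by simp))
  have e2 : ∀ᶠ r in 𝓝 s, ContDiffAt ℝ 1 γ r :=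
    (hγ.of_le (by exact_mod_cast le_top)).eventually (by simp)
  filter_upwards [e1, e2] with r h1 h2
  exact ((h1.differentiableAt (by simp)).hasFDerivAt.comp_hasDerivAt r
    (h2.differentiableAt (by simp)).hasDerivAt).deriv

theorem deriv_comp_curve {E : Type*} [NormedAddCommGroup E] [NormedSpace ℝ E]
    {W : E → ℝ} {γ : ℝ → E} {s : ℝ} (hW : ContDiffAt ℝ ∞ W (γ s)) (hγ : ContDiffAt ℝ ∞ γ s) :
    deriv (fun r => W (γ r)) s = fderiv ℝ W (γ s) (deriv γ s) :=
  (deriv_comp_eventuallyEq hW hγ).eq_of_nhds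

theorem deriv_deriv_comp_curve {E : Type*} [NormedAddCommGroup E] [NormedSpace ℝ E]
    {W : E → ℝ} {γ : ℝ → E} {s : ℝ} (hW : ContDiffAt ℝ ∞ W (γ s)) (hγ : ContDiffAt ℝ ∞ γ s) :
    deriv (deriv fun r => W (γ r)) s =
      fderiv ℝ (fderiv ℝ W) (γ s) (deriv γ s) (deriv γ s) +
        fderiv ℝ W (γ s) (deriv (deriv γ) s) := by
  rw [(deriv_comp_eventuallyEq hW hγ).deriv_eq]
  exact (hasDerivAt_fderiv_comp hW hγ).deriv

/-- By the inverse function theorem `f` can be taken as `F` composed with a local inverse of `B`.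
This yields the transformed function: `B` is the projection to the new base of the image of a graph,
and `F` is the new dependent variable on that graph. -/
theorem exists_contDiffAt_comp_eventuallyEq {E : Type*} [NormedAddCommGroup E] [NormedSpace ℝ E]
    [FiniteDimensional ℝ E] {B : E → E} {F : E → ℝ} {P : E}
    (hB : ContDiffAt ℝ ∞ B P) (hF : ContDiffAt ℝ ∞ F P)
    (hinj : ∀ v, fderiv ℝ B P v = 0 → v = 0) :
    ∃ f : E → ℝ, ContDiffAt ℝ ∞ f (B P) ∧ ∀ᶠ y in 𝓝 P, f (B y) = F y := by
  have : CompleteSpace E := FiniteDimensional.complete ℝ E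
  let L : E ≃ₗ[ℝ] E := LinearEquiv.ofInjectiveEndo (fderiv ℝ B P : E →ₗ[ℝ] E)
    ((injective_iff_map_eq_zero _).2 hinj)
  have hL : HasFDerivAt B (L.toContinuousLinearEquiv : E →L[ℝ] E) P := by
    have : (L.toContinuousLinearEquiv : E →L[ℝ] E) = fderiv ℝ B P := by
      ext v; rfl
    rw [this]
    exact (hB.differentiableAt (by simp)).hasFDerivAt
  refine ⟨fun y => F (hB.localInverse hL (by simp) y), ?_, ?_⟩
  · have hP : hB.localInverse hL (by simp) (B P) = P := hB.localInverse_apply_image hL (by simp)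
    refine ContDiffAt.comp (B P) ?_ (hB.to_localInverse hL (by simp))
    rw [hP]
    exact hF
  · have := (hB.hasStrictFDerivAt' hL (by simp)).eventually_left_inverse
    filter_upwards [this] with y hy
    exact congrArg F hy

theorem PowDefined.ne_zero_or_one_le {n u : ℝ} (h : PowDefined n u) (hn : n ≠ 0) :
    u ≠ 0 ∨ 1 ≤ n := by
  rcases h with h | ⟨h, -⟩ | ⟨-, k, rfl⟩
  · exact .inl h.ne'
  · exact .inl h.ne
  · right
    have : k ≠ 0 := by rintro rfl; simp at hn
    exact_mod_cast Nat.one_le_iff_ne_zero.2 this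

theorem deriv_rpow_comp {f : ℝ → ℝ} {s n : ℝ} (hf : DifferentiableAt ℝ f s)
    (h : PowDefined n (f s)) (hn : n ≠ 0) :
    deriv (fun r => f r ^ n) s = n * f s ^ (n - 1) * deriv f s := by
  have := (Real.hasDerivAt_rpow_const (h.ne_zero_or_one_le hn)).comp s hf.hasDerivAt
  exact this.deriv

/-! ### Quadratic test functions and second-order prolongation. -/

theorem hasDerivAt_quadratic (A B C c s : ℝ) :
    HasDerivAt (fun s => A + B * (s - c) + C / 2 * (s - c) ^ 2) (B + C * (s - c)) s := by
  have h1 : HasDerivAt (fun s : ℝ => s - c) 1 s := (hasDerivAt_id _).sub_const _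
  have h2 : HasDerivAt (fun s : ℝ => (s - c) ^ 2) (2 * (s - c)) s := by
    simpa using h1.fun_pow 2
  have h3 := ((h1.const_mul B).const_add A).add (h2.const_mul (C / 2))
  have e : B + C * (s - c) = B * 1 + C / 2 * (2 * (s - c)) := by ring
  rw [e]
  exact h3

/-- The quadratic polynomial with value `z.2.2` at `(z.1, z.2.1)`, first derivatives `p`, `q`, pure
second derivatives `h`, `r` and zero mixed second derivative there. -/
noncomputable def testFun (z : Var) (p q h r : ℝ) (y : ℝ × ℝ) : ℝ :=
  z.2.2 + p * (y.1 - z.1) + q * (y.2 - z.2.1) + h / 2 * (y.1 - z.1) ^ 2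
    + r / 2 * (y.2 - z.2.1) ^ 2

theorem contDiff_testFun (z : Var) (p q h r : ℝ) : ContDiff ℝ ∞ (testFun z p q h r) := by
  unfold testFun
  fun_prop

theorem testFun_base (z : Var) (p q h r : ℝ) : testFun z p q h r (z.1, z.2.1) = z.2.2 := by
  simp [testFun]

/-- The lift of the line `s ↦ (z.1, z.2.1) + s • v` to the graph of `testFun z p q h r`. -/
noncomputable def testCurve (z : Var) (p q h r : ℝ) (v : ℝ × ℝ) (s : ℝ) : Var :=
  (z.1 + s * v.1, z.2.1 + s * v.2,
    z.2.2 + s * (p * v.1 + q * v.2) + s ^ 2 * ((h * v.1 ^ 2 + r * v.2 ^ 2) / 2))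

theorem contDiff_testCurve (z : Var) (p q h r : ℝ) (v : ℝ × ℝ) :
    ContDiff ℝ ∞ (testCurve z p q h r v) := by
  unfold testCurve
  fun_prop

theorem testCurve_zero (z : Var) (p q h r : ℝ) (v : ℝ × ℝ) : testCurve z p q h r v 0 = z := by
  simp [testCurve]

theorem testCurve_eq (z : Var) (p q h r : ℝ) (v : ℝ × ℝ) (s : ℝ) :
    testCurve z p q h r v s = (z.1 + s * v.1, z.2.1 + s * v.2,
      testFun z p q h r (z.1 + s * v.1, z.2.1 + s * v.2)) := by
  simp only [testCurve, testFun, Prod.mk.injEq, true_and]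
  ring

theorem hasDerivAt_testCurve (z : Var) (p q h r : ℝ) (v : ℝ × ℝ) (s : ℝ) :
    HasDerivAt (testCurve z p q h r v)
      (v.1, v.2, p * v.1 + q * v.2 + s * (h * v.1 ^ 2 + r * v.2 ^ 2)) s := by
  unfold testCurve
  refine HasDerivAt.prodMk ?_ (HasDerivAt.prodMk ?_ ?_)
  · simpa using ((hasDerivAt_id s).mul_const v.1).const_add z.1
  · simpa using ((hasDerivAt_id s).mul_const v.2).const_add z.2.1
  · have e : (fun s => z.2.2 + s * (p * v.1 + q * v.2)
        + s ^ 2 * ((h * v.1 ^ 2 + r * v.2 ^ 2) / 2)) = fun s => z.2.2 +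
        (p * v.1 + q * v.2) * (s - 0) + (h * v.1 ^ 2 + r * v.2 ^ 2) / 2 * (s - 0) ^ 2 := by
      funext s; ring
    rw [e]
    exact (hasDerivAt_quadratic _ _ _ _ _).congr_deriv (by ring)

theorem deriv_testCurve (z : Var) (p q h r : ℝ) (v : ℝ × ℝ) :
    deriv (testCurve z p q h r v) 0 = (v.1, v.2, p * v.1 + q * v.2) := by
  rw [(hasDerivAt_testCurve z p q h r v 0).deriv]
  simp

theorem deriv_deriv_testCurve (z : Var) (p q h r : ℝ) (v : ℝ × ℝ) :
    deriv (deriv (testCurve z p q h r v)) 0 = (0, 0, h * v.1 ^ 2 + r * v.2 ^ 2) := by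
  have : deriv (testCurve z p q h r v) =
      fun s => (v.1, v.2, p * v.1 + q * v.2 + s * (h * v.1 ^ 2 + r * v.2 ^ 2)) :=
    funext fun s => (hasDerivAt_testCurve z p q h r v s).deriv
  rw [this]
  refine HasDerivAt.deriv (HasDerivAt.prodMk (hasDerivAt_const _ _)
    (HasDerivAt.prodMk (hasDerivAt_const _ _) ?_))
  simpa using ((hasDerivAt_id (0 : ℝ)).mul_const (h * v.1 ^ 2 + r * v.2 ^ 2)).const_add
    (p * v.1 + q * v.2)

theorem deriv_pair {α β : ℝ → ℝ} {s : ℝ} (hα : DifferentiableAt ℝ α s)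
    (hβ : DifferentiableAt ℝ β s) :
    deriv (fun r => (α r, β r)) s = (deriv α s, deriv β s) :=
  (hα.hasDerivAt.prodMk hβ.hasDerivAt).deriv

theorem deriv_deriv_pair {α β : ℝ → ℝ} {s : ℝ} (hα : ContDiffAt ℝ ∞ α s)
    (hβ : ContDiffAt ℝ ∞ β s) :
    deriv (deriv fun r => (α r, β r)) s = (deriv (deriv α) s, deriv (deriv β) s) := by
  have e : deriv (fun r => (α r, β r)) =ᶠ[𝓝 s] fun r => (deriv α r, deriv β r) := by
    filter_upwards [(hα.of_le (m := 1) (by exact_mod_cast le_top)).eventually (by simp),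
      (hβ.of_le (m := 1) (by exact_mod_cast le_top)).eventually (by simp)] with r h1 h2
    exact deriv_pair (h1.differentiableAt (by simp)) (h2.differentiableAt (by simp))
  have d : ∀ {δ : ℝ → ℝ}, ContDiffAt ℝ ∞ δ s → DifferentiableAt ℝ (deriv δ) s := by
    intro δ hδ
    have : ContDiffAt ℝ ∞ (deriv δ) s :=
      (hδ.fderiv_right (m := ∞) (by simp)).clm_apply (contDiffAt_const (c := (1 : ℝ)))
    exact this.differentiableAt (by simp)
  rw [e.deriv_eq]
  exact deriv_pair (d hα) (d hβ)

/-- Prolongation to second-order jets of the point transformation `(T, X, U)`, in implicit form: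
`ut`, `ux`, `uxx` are the transformed derivatives. -/
theorem exists_prolongation {Ω : Set Var} (hΩ : IsOpen Ω) {T X U : Var → ℝ}
    (hT : ContDiffOn ℝ ∞ T Ω) (hX : ContDiffOn ℝ ∞ X Ω) (hU : ContDiffOn ℝ ∞ U Ω)
    {z : Var} (hz : z ∈ Ω) (p q h r : ℝ)
    (hnd : ∀ v : ℝ × ℝ, fderiv ℝ T z (v.1, v.2, p * v.1 + q * v.2) = 0 →
      fderiv ℝ X z (v.1, v.2, p * v.1 + q * v.2) = 0 → v = 0) :
    ∃ ut ux uxx : ℝ,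
      (∀ v : ℝ × ℝ, fderiv ℝ U z (v.1, v.2, p * v.1 + q * v.2) =
        ut * fderiv ℝ T z (v.1, v.2, p * v.1 + q * v.2) +
        ux * fderiv ℝ X z (v.1, v.2, p * v.1 + q * v.2)) ∧
      (∀ v : ℝ × ℝ, ∀ w : Var, w = (v.1, v.2, p * v.1 + q * v.2) → fderiv ℝ T z w = 0 →
        fderiv ℝ (fderiv ℝ U) z w w + fderiv ℝ U z (0, 0, h * v.1 ^ 2 + r * v.2 ^ 2) =
          uxx * fderiv ℝ X z w ^ 2 +
          ut * (fderiv ℝ (fderiv ℝ T) z w w + fderiv ℝ T z (0, 0, h * v.1 ^ 2 + r * v.2 ^ 2)) +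
          ux * (fderiv ℝ (fderiv ℝ X) z w w
            + fderiv ℝ X z (0, 0, h * v.1 ^ 2 + r * v.2 ^ 2))) ∧
      ∀ (a n : ℝ) (g : ℝ → ℝ) (a' n' : ℝ) (g' : ℝ → ℝ),
        PowDefined n z.2.2 → n ≠ 0 → PowDefined n' (U z) → n' ≠ 0 →
        MapsEquation Ω (fun z => (T z, X z, U z)) a n g a' n' g' →
        (p + a * (n * z.2.2 ^ (n - 1) * q) = g z.1 * r ↔
          ut + a' * (n' * U z ^ (n' - 1) * ux) = g' (T z) * uxx) := by
  have hTz : ContDiffAt ℝ ∞ T z := hT.contDiffAt (hΩ.mem_nhds hz)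
  have hXz : ContDiffAt ℝ ∞ X z := hX.contDiffAt (hΩ.mem_nhds hz)
  have hUz : ContDiffAt ℝ ∞ U z := hU.contDiffAt (hΩ.mem_nhds hz)
  set P : ℝ × ℝ := (z.1, z.2.1) with hP
  set f := testFun z p q h r with hf
  have hfP : f P = z.2.2 := testFun_base z p q h r
  have hfs : ContDiff ℝ ∞ f := contDiff_testFun z p q h r
  set G : ℝ × ℝ → Var := fun y => (y.1, y.2, f y) with hG
  have hGs : ContDiff ℝ ∞ G := by fun_prop
  have hGP : G P = z := by
    have : G P = (z.1, z.2.1, f P) := rfl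
    rw [this, hfP]
  have line : ∀ v : ℝ × ℝ, ContDiff ℝ ∞ fun s : ℝ => (z.1 + s * v.1, z.2.1 + s * v.2) := by
    intro v; fun_prop
  have hline0 : ∀ v : ℝ × ℝ, deriv (fun s : ℝ => (z.1 + s * v.1, z.2.1 + s * v.2)) 0 = v := by
    intro v
    refine HasDerivAt.deriv (HasDerivAt.prodMk (f₂' := v.2) (f₁' := v.1) ?_ ?_)
    · simpa using ((hasDerivAt_id (0 : ℝ)).mul_const v.1).const_add z.1
    · simpa using ((hasDerivAt_id (0 : ℝ)).mul_const v.2).const_add z.2.1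
  -- derivatives along lifted curves
  have along : ∀ {W : Var → ℝ}, ContDiffAt ℝ ∞ W z → ∀ v : ℝ × ℝ,
      ContDiffAt ℝ ∞ (fun s => W (testCurve z p q h r v s)) 0 ∧
      deriv (fun s => W (testCurve z p q h r v s)) 0 =
        fderiv ℝ W z (v.1, v.2, p * v.1 + q * v.2) ∧
      deriv (deriv fun s => W (testCurve z p q h r v s)) 0 =
        fderiv ℝ (fderiv ℝ W) z (v.1, v.2, p * v.1 + q * v.2) (v.1, v.2, p * v.1 + q * v.2) +
          fderiv ℝ W z (0, 0, h * v.1 ^ 2 + r * v.2 ^ 2) := by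
    intro W hW v
    have hc := (contDiff_testCurve z p q h r v).contDiffAt (x := 0)
    have hW' : ContDiffAt ℝ ∞ W (testCurve z p q h r v 0) := by rwa [testCurve_zero]
    refine ⟨hW'.comp 0 hc, ?_, ?_⟩
    · rw [deriv_comp_curve hW' hc, deriv_testCurve, testCurve_zero]
    · rw [deriv_deriv_comp_curve hW' hc, deriv_testCurve, deriv_deriv_testCurve, testCurve_zero]
  have GW : ∀ {W : Var → ℝ}, ContDiffAt ℝ ∞ W z →
      ContDiffAt ℝ ∞ (fun y => W (G y)) P ∧ ∀ v : ℝ × ℝ,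
        fderiv ℝ (fun y => W (G y)) P v = fderiv ℝ W z (v.1, v.2, p * v.1 + q * v.2) := by
    intro W hW
    have h1 : ContDiffAt ℝ ∞ (fun y => W (G y)) P :=
      ContDiffAt.comp P (by rwa [hGP]) hGs.contDiffAt
    refine ⟨h1, fun v => ?_⟩
    have h2 := deriv_comp_curve (W := fun y => W (G y))
      (γ := fun s : ℝ => (z.1 + s * v.1, z.2.1 + s * v.2)) (s := 0)
      (by simpa using h1) (line v).contDiffAt
    rw [hline0] at h2
    simp only [zero_mul, add_zero] at h2
    rw [← h2, ← ((along hW v).2.1)]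
    simp only [testCurve_eq, hG, hf]
  obtain ⟨hTG, hTd⟩ := GW hTz
  obtain ⟨hXG, hXd⟩ := GW hXz
  obtain ⟨hUG, hUd⟩ := GW hUz
  set B : ℝ × ℝ → ℝ × ℝ := fun y => (T (G y), X (G y)) with hB
  have hBs : ContDiffAt ℝ ∞ B P := hTG.prodMk hXG
  have hBP : B P = (T z, X z) := by simp only [hB, hGP]
  have hBd : ∀ v, fderiv ℝ B P v = (fderiv ℝ T z (v.1, v.2, p * v.1 + q * v.2),
      fderiv ℝ X z (v.1, v.2, p * v.1 + q * v.2)) := by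
    intro v
    rw [← hTd, ← hXd]
    have := ((hTG.differentiableAt (by simp)).hasFDerivAt.prodMk
      (hXG.differentiableAt (by simp)).hasFDerivAt).fderiv
    exact congrArg (fun L => L v) this
  -- The transformed function exists because `hnd` says that the image of the graph is not vertical
  -- over `z`.
  obtain ⟨f', hf's, hf'⟩ := exists_contDiffAt_comp_eventuallyEq hBs hUG (by
    intro v hv
    rw [hBd, Prod.mk_eq_zero] at hv
    exact hnd v hv.1 hv.2)
  have hf's' : ContDiffAt ℝ ∞ f' (T z, X z) := hBP ▸ hf's
  have hct : ContDiff ℝ ∞ fun s : ℝ => (s, X z) := by fun_prop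
  have hcx : ContDiff ℝ ∞ fun s : ℝ => (T z, s) := by fun_prop
  have hdt : ∀ s, deriv (fun s : ℝ => (s, X z)) s = (1, 0) := fun s =>
    ((hasDerivAt_id s).prodMk (hasDerivAt_const s (X z))).deriv
  have hdx : ∀ s, deriv (fun s : ℝ => (T z, s)) s = (0, 1) := fun s =>
    ((hasDerivAt_const s (T z)).prodMk (hasDerivAt_id s)).deriv
  have e_ut := deriv_comp_curve (W := f') (γ := fun s : ℝ => (s, X z)) hf's' hct.contDiffAt
  have e_ux := deriv_comp_curve (W := f') (γ := fun s : ℝ => (T z, s)) hf's' hcx.contDiffAt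
  have e_uxx := deriv_deriv_comp_curve (W := f') (γ := fun s : ℝ => (T z, s)) hf's'
    hcx.contDiffAt
  rw [hdt] at e_ut
  rw [hdx] at e_ux
  have hdxx : deriv (deriv fun s : ℝ => (T z, s)) (X z) = 0 := by
    rw [funext hdx]; simp
  rw [hdx, hdxx, map_zero, add_zero] at e_uxx
  refine ⟨fderiv ℝ f' (T z, X z) (1, 0), fderiv ℝ f' (T z, X z) (0, 1),
    fderiv ℝ (fderiv ℝ f') (T z, X z) (0, 1) (0, 1), ?_, ?_, ?_⟩
  · intro v
    have h1 : fderiv ℝ (fun y => U (G y)) P v = fderiv ℝ f' (B P) (fderiv ℝ B P v) := by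
      have e : (fun y => U (G y)) =ᶠ[𝓝 P] f' ∘ B := hf'.mono fun y hy => hy.symm
      rw [e.fderiv_eq, fderiv_comp P (hf's.differentiableAt (by simp))
        (hBs.differentiableAt (by simp))]
      rfl
    rw [← hUd, h1, hBd, hBP]
    generalize fderiv ℝ T z (v.1, v.2, p * v.1 + q * v.2) = α
    generalize fderiv ℝ X z (v.1, v.2, p * v.1 + q * v.2) = β
    have : ((α, β) : ℝ × ℝ) = α • (1, 0) + β • (0, 1) := by simp
    rw [this, map_add, map_smul, map_smul, smul_eq_mul, smul_eq_mul]
    ring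
  · rintro v w hw hTw
    obtain ⟨aT, aT1, aT2⟩ := along hTz v
    obtain ⟨aX, aX1, aX2⟩ := along hXz v
    obtain ⟨aU, aU1, aU2⟩ := along hUz v
    rw [← hw] at aT1 aT2 aX1 aX2 aU1 aU2
    set γ : ℝ → ℝ × ℝ := fun s =>
      (T (testCurve z p q h r v s), X (testCurve z p q h r v s)) with hγ
    have hγs : ContDiffAt ℝ ∞ γ 0 := aT.prodMk aX
    have hγ0 : γ 0 = (T z, X z) := by simp [hγ, testCurve_zero]
    -- Since the differential of `T` kills `w`, the projected curve starts in the new `x`-direction.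
    -- Hence the second derivative of `f'` along it involves only the transformed `u_xx`, not the
    -- mixed or `t`-derivatives.
    have hγ1 : deriv γ 0 = (0, fderiv ℝ X z w) := by
      rw [hγ, deriv_pair (aT.differentiableAt (by simp)) (aX.differentiableAt (by simp)),
        aT1, aX1, hTw]
    have hγ2 := deriv_deriv_pair aT aX
    rw [aT2, aX2] at hγ2
    have e : (fun s => U (testCurve z p q h r v s)) =ᶠ[𝓝 0] fun s => f' (γ s) := by
      have hl : Tendsto (fun s : ℝ => (z.1 + s * v.1, z.2.1 + s * v.2)) (𝓝 0) (𝓝 P) := by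
        have := (line v).continuous.tendsto 0
        simpa using this
      filter_upwards [hl.eventually hf'] with s hs
      simp only [hγ, testCurve_eq]
      exact hs.symm
    have key := deriv_deriv_comp_curve (W := f') (γ := γ) (s := 0) (by rwa [hγ0]) hγs
    rw [← e.deriv.deriv_eq, aU2, hγ0, hγ1, hγ2] at key
    rw [key]
    generalize fderiv ℝ X z w = β
    generalize fderiv ℝ (fderiv ℝ T) z w w + fderiv ℝ T z (0, 0, h * v.1 ^ 2 + r * v.2 ^ 2) = α'
    generalize fderiv ℝ (fderiv ℝ X) z w w + fderiv ℝ X z (0, 0, h * v.1 ^ 2 + r * v.2 ^ 2) = β'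
    have h1 : ((0, β) : ℝ × ℝ) = β • (0, 1) := by simp
    have h2 : ((α', β') : ℝ × ℝ) = α' • (1, 0) + β' • (0, 1) := by simp
    rw [h1, h2]
    simp only [map_add, map_smul, smul_eq_mul, smul_apply]
    ring
  · intro a n g a' n' g' hpow hn hpow' hn' hmaps
    have hbase : basePoint (fun z => (T z, X z, U z)) f P = (T z, X z) := hBP
    have key := hmaps f f' P (by rw [hfP]; exact hz) hfs.contDiffAt (by rwa [hbase])
      (by
        exact hf')
    rw [hbase] at key
    have hf'P : f' (T z, X z) = U z := by
      have := hf'.self_of_nhds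
      rwa [hBP, hGP] at this
    have d1 : deriv (fun t => f (t, P.2)) P.1 = p := by
      have e : (fun t => f (t, P.2)) = fun t => z.2.2 + p * (t - z.1) + h / 2 * (t - z.1) ^ 2 := by
        funext t; simp [hf, testFun, hP]
      rw [e, (hasDerivAt_quadratic _ _ _ _ _).deriv]
      simp [hP]
    have dx : ∀ x, HasDerivAt (fun x => f (P.1, x)) (q + r * (x - z.2.1)) x := by
      intro x
      have e : (fun x => f (P.1, x)) =
          fun x => z.2.2 + q * (x - z.2.1) + r / 2 * (x - z.2.1) ^ 2 := by
        funext t; simp [hf, testFun, hP]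
      rw [e]
      exact hasDerivAt_quadratic _ _ _ _ _
    have d2 : deriv (fun x => f (P.1, x)) P.2 = q := by
      rw [(dx _).deriv]; simp [hP]
    have d3 : iteratedDeriv 2 (fun x => f (P.1, x)) P.2 = r := by
      rw [iteratedDeriv_succ, iteratedDeriv_one, funext fun x => (dx x).deriv]
      refine HasDerivAt.deriv ?_
      have h1 : HasDerivAt (fun t : ℝ => t - z.2.1) 1 P.2 := (hasDerivAt_id _).sub_const _
      simpa using (h1.const_mul r).const_add q
    have d4 : deriv (fun x => f (P.1, x) ^ n) P.2 = n * z.2.2 ^ (n - 1) * q := by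
      have hPP : f (P.1, P.2) = z.2.2 := hfP
      rw [deriv_rpow_comp (f := fun x => f (P.1, x)) (dx _).differentiableAt
        (by simpa only [hPP] using hpow) hn, d2, hPP]
    have d5 : deriv (fun x => f' (T z, x) ^ n') (X z) =
        n' * U z ^ (n' - 1) * fderiv ℝ f' (T z, X z) (0, 1) := by
      have : DifferentiableAt ℝ (fun x => f' (T z, x)) (X z) :=
        (ContDiffAt.comp (X z) hf's' hcx.contDiffAt).differentiableAt (by simp)
      rw [deriv_rpow_comp this (by rwa [hf'P]) hn', hf'P, e_ux]
    unfold SatisfiesAt at key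
    rw [d1, d3, d4, iteratedDeriv_succ, iteratedDeriv_one] at key
    simp only [e_ut, e_uxx, d5] at key
    exact key

/-! ### Differentials and second differentials in coordinates. -/

/-- The direction of the `t`-axis. -/
abbrev et : Var := (1, 0, 0)

/-- The direction of the `x`-axis. -/
abbrev ex : Var := (0, 1, 0)

/-- The direction of the `u`-axis. -/
abbrev eu : Var := (0, 0, 1)

theorem clm_apply_eq (L : Var →L[ℝ] ℝ) (α β γ : ℝ) :
    L (α, β, γ) = α * L et + β * L ex + γ * L eu := by
  have : ((α, β, γ) : Var) = α • et + β • ex + γ • eu := by simp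
  rw [this, map_add, map_add, map_smul, map_smul, map_smul]
  rfl

theorem clm_apply₂_eq (L : Var →L[ℝ] Var →L[ℝ] ℝ) (hL : L eu ex = L ex eu) (q : ℝ) :
    L (0, 1, q) (0, 1, q) = L ex ex + 2 * q * L ex eu + q ^ 2 * L eu eu := by
  have : ((0, 1, q) : Var) = ex + q • eu := by simp
  rw [this]
  simp only [map_add, map_smul, add_apply, smul_apply, smul_eq_mul, hL]
  ring

theorem fderiv_fderiv_apply {W : Var → ℝ} {z : Var} (hW : ContDiffAt ℝ ∞ W z) (e v : Var) :
    fderiv ℝ (fun y => fderiv ℝ W y e) z v = fderiv ℝ (fderiv ℝ W) z v e := by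
  have h : DifferentiableAt ℝ (fderiv ℝ W) z :=
    (hW.fderiv_right (m := ∞) (by simp)).differentiableAt (by simp)
  have := (h.hasFDerivAt.clm_apply (hasFDerivAt_const e z)).fderiv
  rw [this]
  simp

theorem fderiv_fderiv_comm {W : Var → ℝ} {z : Var} (hW : ContDiffAt ℝ ∞ W z) (v w : Var) :
    fderiv ℝ (fderiv ℝ W) z v w = fderiv ℝ (fderiv ℝ W) z w v :=
  (hW.isSymmSndFDerivAt (by
    rw [minSmoothness_of_isRCLikeNormedField]
    exact WithTop.coe_le_coe.2 le_top)).eq v w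

theorem fderiv_fderiv_eq_zero {Ω : Set Var} (hΩ : IsOpen Ω) {W : Var → ℝ}
    (hW : ContDiffOn ℝ ∞ W Ω) {e : Var} (h : ∀ z ∈ Ω, fderiv ℝ W z e = 0) {z : Var} (hz : z ∈ Ω)
    (v : Var) : fderiv ℝ (fderiv ℝ W) z v e = 0 := by
  rw [← fderiv_fderiv_apply (hW.contDiffAt (hΩ.mem_nhds hz))]
  have : (fun y => fderiv ℝ W y e) =ᶠ[𝓝 z] fun _ => 0 := by
    filter_upwards [hΩ.mem_nhds hz] with y hy using h y hy
  rw [this.fderiv_eq]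
  simp

theorem contDiffOn_fderiv_apply {Ω : Set Var} (hΩ : IsOpen Ω) {W : Var → ℝ}
    (hW : ContDiffOn ℝ ∞ W Ω) (e : Var) : ContDiffOn ℝ ∞ (fun z => fderiv ℝ W z e) Ω :=
  (hW.fderiv_of_isOpen hΩ (by simp)).clm_apply contDiffOn_const

/-! ### `T` depends on `t` only and `X` does not depend on `u`. -/

/-- `(T, X, U)` is a smooth map of the open set `Ω` with nondegenerate differential. -/
structure Nondegenerate (Ω : Set Var) (T X U : Var → ℝ) : Prop where
  isOpen : IsOpen Ω
  smooth_T : ContDiffOn ℝ ∞ T Ω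
  smooth_X : ContDiffOn ℝ ∞ X Ω
  smooth_U : ContDiffOn ℝ ∞ U Ω
  surj : ∀ z ∈ Ω, ∀ α β γ : ℝ,
    ∃ w : Var, fderiv ℝ T z w = α ∧ fderiv ℝ X z w = β ∧ fderiv ℝ U z w = γ

/-- `(T, X, U)` maps the equation with arbitrary elements `(a, n, g)`, where `g` is constant, to the
one with arbitrary elements `(a', n', g')`. -/
structure MapsConstEquation (Ω : Set Var) (T X U : Var → ℝ) (a n g a' n' : ℝ) (g' : ℝ → ℝ) :
    Prop where
  a_ne : a ≠ 0
  n_ne_zero : n ≠ 0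
  n_ne_one : n ≠ 1
  g_ne : g ≠ 0
  a'_ne : a' ≠ 0
  n'_ne_zero : n' ≠ 0
  n'_ne_one : n' ≠ 1
  g'_ne : ∀ z ∈ Ω, g' (T z) ≠ 0
  pow : ∀ z ∈ Ω, PowDefined n z.2.2
  pow' : ∀ z ∈ Ω, PowDefined n' (U z)
  maps : MapsEquation Ω (fun z => (T z, X z, U z)) a n (fun _ => g) a' n' g'

section Steps

variable {Ω : Set Var} {T X U : Var → ℝ} {a n g a' n' : ℝ} {g' : ℝ → ℝ}

/-- The quantity in `hΔ` is the Jacobian of `(T, X)` with respect to the total derivatives in `t`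
and `x`; Cramer's rule then gives the non-verticality required by `exists_prolongation`. The
transformed derivatives are chosen before the equation, so they serve all equations at once. -/
theorem exists_prolongation_coord (H : Nondegenerate Ω T X U) {z : Var} (hz : z ∈ Ω)
    (p q h r : ℝ)
    (hΔ : (fderiv ℝ T z et + p * fderiv ℝ T z eu) * (fderiv ℝ X z ex + q * fderiv ℝ X z eu) -
      (fderiv ℝ T z ex + q * fderiv ℝ T z eu) * (fderiv ℝ X z et + p * fderiv ℝ X z eu) ≠ 0) :
    ∃ ut ux uxx : ℝ,
      fderiv ℝ U z et + p * fderiv ℝ U z eu = ut * (fderiv ℝ T z et + p * fderiv ℝ T z eu) +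
        ux * (fderiv ℝ X z et + p * fderiv ℝ X z eu) ∧
      fderiv ℝ U z ex + q * fderiv ℝ U z eu = ut * (fderiv ℝ T z ex + q * fderiv ℝ T z eu) +
        ux * (fderiv ℝ X z ex + q * fderiv ℝ X z eu) ∧
      (∀ v : ℝ × ℝ, ∀ w : Var, w = (v.1, v.2, p * v.1 + q * v.2) → fderiv ℝ T z w = 0 →
        fderiv ℝ (fderiv ℝ U) z w w + (h * v.1 ^ 2 + r * v.2 ^ 2) * fderiv ℝ U z eu =
          uxx * fderiv ℝ X z w ^ 2 +
          ut * (fderiv ℝ (fderiv ℝ T) z w w + (h * v.1 ^ 2 + r * v.2 ^ 2) * fderiv ℝ T z eu) +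
          ux * (fderiv ℝ (fderiv ℝ X) z w w + (h * v.1 ^ 2 + r * v.2 ^ 2) * fderiv ℝ X z eu)) ∧
      ∀ (a n g a' n' : ℝ) (g' : ℝ → ℝ), MapsConstEquation Ω T X U a n g a' n' g' →
        p + a * (n * z.2.2 ^ (n - 1) * q) = g * r →
          ut + a' * (n' * U z ^ (n' - 1) * ux) = g' (T z) * uxx := by
  obtain ⟨ut, ux, uxx, h1, h2, h3⟩ := exists_prolongation H.isOpen H.smooth_T H.smooth_X
    H.smooth_U hz p q h r (by
      rintro ⟨v1, v2⟩ h1 h2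
      rw [clm_apply_eq] at h1 h2
      dsimp only at h1 h2
      have e1 := (mul_eq_zero.1 (show _ * v1 = 0 by
        linear_combination (fderiv ℝ X z ex + q * fderiv ℝ X z eu) * h1 -
          (fderiv ℝ T z ex + q * fderiv ℝ T z eu) * h2)).resolve_left hΔ
      have e2 := (mul_eq_zero.1 (show _ * v2 = 0 by
        linear_combination (fderiv ℝ T z et + p * fderiv ℝ T z eu) * h2 -
          (fderiv ℝ X z et + p * fderiv ℝ X z eu) * h1)).resolve_left hΔ
      rw [e1, e2]; rfl)
  refine ⟨ut, ux, uxx, ?_, ?_, ?_, ?_⟩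
  · have := h1 (1, 0)
    rw [clm_apply_eq (fderiv ℝ U z), clm_apply_eq (fderiv ℝ T z),
      clm_apply_eq (fderiv ℝ X z)] at this
    linear_combination this
  · have := h1 (0, 1)
    rw [clm_apply_eq (fderiv ℝ U z), clm_apply_eq (fderiv ℝ T z),
      clm_apply_eq (fderiv ℝ X z)] at this
    linear_combination this
  · intro v w hw hT
    have := h2 v w hw hT
    rw [clm_apply_eq (fderiv ℝ U z) 0 0, clm_apply_eq (fderiv ℝ T z) 0 0,
      clm_apply_eq (fderiv ℝ X z) 0 0] at this
    linear_combination this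
  · intro a n g a' n' g' E hp
    exact (h3 _ _ _ _ _ _ (E.pow z hz) E.n_ne_zero (E.pow' z hz) E.n'_ne_zero E.maps).1 hp

/-- Compare two jets on the equation that differ only in `u_tt`. The transformed first derivatives
agree, and so does the transformed `u_xx`, which the target equation determines because `g'` is
nonzero. The second-order chain rule then leaves no room for the change of `u_tt` unless the total
`x`-derivative of `T` vanishes. -/
theorem total_deriv_T_eq_zero (H : Nondegenerate Ω T X U)
    (E : MapsConstEquation Ω T X U a n g a' n' g') {z : Var} (hz : z ∈ Ω) (p q : ℝ)
    (hΔ : (fderiv ℝ T z et + p * fderiv ℝ T z eu) * (fderiv ℝ X z ex + q * fderiv ℝ X z eu) -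
      (fderiv ℝ T z ex + q * fderiv ℝ T z eu) * (fderiv ℝ X z et + p * fderiv ℝ X z eu) ≠ 0) :
    fderiv ℝ T z ex + q * fderiv ℝ T z eu = 0 := by
  -- This value of `u_xx` puts the jet on the equation.
  set r : ℝ := (p + a * (n * z.2.2 ^ (n - 1) * q)) / g with hr
  have hr' : p + a * (n * z.2.2 ^ (n - 1) * q) = g * r := by
    rw [hr]; field_simp [E.g_ne]
  obtain ⟨ut, ux, uxx, i10, i01, i2, i3⟩ := exists_prolongation_coord H hz p q 0 r hΔ
  obtain ⟨vt, vx, vxx, j10, j01, j2, j3⟩ := exists_prolongation_coord H hz p q 1 r hΔ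
  have k1 := i3 _ _ _ _ _ _ E hr'
  have k2 := j3 _ _ _ _ _ _ E hr'
  have l1 := i10.symm.trans j10
  have l2 := i01.symm.trans j01
  have et' : ut = vt := by
    have := (mul_eq_zero.1 (show _ * (ut - vt) = 0 by
      linear_combination (fderiv ℝ X z ex + q * fderiv ℝ X z eu) * l1 -
        (fderiv ℝ X z et + p * fderiv ℝ X z eu) * l2)).resolve_left hΔ
    linarith
  have ex' : ux = vx := by
    have := (mul_eq_zero.1 (show _ * (ux - vx) = 0 by
      linear_combination (fderiv ℝ T z et + p * fderiv ℝ T z eu) * l2 -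
        (fderiv ℝ T z ex + q * fderiv ℝ T z eu) * l1)).resolve_left hΔ
    linarith
  subst et' ex'
  have exx' : uxx = vxx := mul_left_cancel₀ (E.g'_ne z hz) (k1.symm.trans k2)
  subst exx'
  -- The lift of `v` to the tangent plane of the graph is annihilated by the differential of `T`.
  set v : ℝ × ℝ := (-(fderiv ℝ T z ex + q * fderiv ℝ T z eu),
    fderiv ℝ T z et + p * fderiv ℝ T z eu) with hv
  have hTv : fderiv ℝ T z (v.1, v.2, p * v.1 + q * v.2) = 0 := by
    rw [clm_apply_eq]; simp only [hv]; ring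
  have m1 := i2 v _ rfl hTv
  have m2 := j2 v _ rfl hTv
  have m : v.1 ^ 2 * (fderiv ℝ U z eu - ut * fderiv ℝ T z eu - ux * fderiv ℝ X z eu) = 0 := by
    linear_combination m2 - m1
  rcases mul_eq_zero.1 m with h | h
  · have := pow_eq_zero_iff (two_ne_zero) |>.1 h
    simp only [hv] at this
    linarith
  -- Otherwise the differential of `U` would be `ut` times that of `T` plus `ux` times that of `X`,
  -- contrary to nondegeneracy.
  · exfalso
    obtain ⟨⟨w1, w2, w3⟩, h1, h2, h3⟩ := H.surj z hz 0 0 1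
    rw [clm_apply_eq] at h1 h2 h3
    have : (0 : ℝ) = 1 := by
      linear_combination h3 - ut * h1 - ux * h2 - w1 * i10 - w2 * i01
        - (w3 - (p * w1 + q * w2)) * h
    exact zero_ne_one this

theorem fderiv_T_eq_zero (H : Nondegenerate Ω T X U)
    (E : MapsConstEquation Ω T X U a n g a' n' g') {z : Var} (hz : z ∈ Ω) :
    fderiv ℝ T z ex = 0 ∧ fderiv ℝ T z eu = 0 := by
  have key : ∀ p q : ℝ, (fderiv ℝ T z ex + q * fderiv ℝ T z eu) *
      ((fderiv ℝ T z et + p * fderiv ℝ T z eu) * (fderiv ℝ X z ex + q * fderiv ℝ X z eu) -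
      (fderiv ℝ T z ex + q * fderiv ℝ T z eu) * (fderiv ℝ X z et + p * fderiv ℝ X z eu)) = 0 := by
    intro p q
    by_contra h
    exact h (by rw [total_deriv_T_eq_zero H E hz p q (right_ne_zero_of_mul h), zero_mul])
  obtain ⟨⟨v1, v2, v3⟩, h1, h2, -⟩ := H.surj z hz 1 0 0
  obtain ⟨⟨w1, w2, w3⟩, h3, h4, -⟩ := H.surj z hz 0 1 0
  rw [clm_apply_eq] at h1 h2 h3 h4
  generalize fderiv ℝ T z et = Tt at *
  generalize fderiv ℝ T z ex = Tx at *
  generalize fderiv ℝ T z eu = Tu at *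
  generalize fderiv ℝ X z et = Xt at *
  generalize fderiv ℝ X z ex = Xx at *
  generalize fderiv ℝ X z eu = Xu at *
  -- Cauchy–Binet: the `2 × 2` minors of the differential of `(T, X)` cannot all vanish.
  have hdet : (Tt * Xx - Tx * Xt) * (v1 * w2 - v2 * w1) + (Tu * Xx - Tx * Xu) *
      (v3 * w2 - v2 * w3) + (Tt * Xu - Tu * Xt) * (v1 * w3 - v3 * w1) = 1 := by
    linear_combination (w1 * Xt + w2 * Xx + w3 * Xu) * h1 + h4 -
      (v1 * Xt + v2 * Xx + v3 * Xu) * h3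
  -- The expression in `key` is a polynomial in `p`, `q` with monomials `1, p, q, q², pq`, so five
  -- values determine its coefficients, which are products of `Tx`, `Tu` with the minors.
  have k00 := key 0 0
  have k10 := key 1 0
  have k01 := key 0 1
  have k02 := key 0 (-1)
  have k11 := key 1 1
  have a0 : Tx * (Tt * Xx - Tx * Xt) = 0 := by linear_combination k00
  have a1 : Tx * (Tu * Xx - Tx * Xu) = 0 := by linear_combination k10 - k00
  have a2 : Tu * (Tt * Xu - Tu * Xt) = 0 := by linear_combination (k01 + k02) / 2 - k00
  have a3 : Tx * (Tt * Xu - Tu * Xt) + Tu * (Tt * Xx - Tx * Xt) = 0 := by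
    linear_combination (k01 - k02) / 2
  have a4 : Tu * (Tu * Xx - Tx * Xu) = 0 := by linear_combination k11 - k01 - a1
  have hTx : Tx = 0 := by
    by_contra h
    have b0 := (mul_eq_zero.1 a0).resolve_left h
    have b1 := (mul_eq_zero.1 a1).resolve_left h
    rw [b0, mul_zero, add_zero] at a3
    have b2 := (mul_eq_zero.1 a3).resolve_left h
    rw [b0, b1, b2] at hdet
    norm_num at hdet
  refine ⟨hTx, ?_⟩
  by_contra h
  rw [hTx, zero_mul, zero_add] at a3
  have b0 := (mul_eq_zero.1 a3).resolve_left h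
  have b1 := (mul_eq_zero.1 a4).resolve_left h
  have b2 := (mul_eq_zero.1 a2).resolve_left h
  rw [hTx] at hdet b1
  rw [b2, b1] at hdet
  rw [b0] at hdet
  norm_num at hdet

theorem fderiv_T_et_ne_zero (H : Nondegenerate Ω T X U)
    (E : MapsConstEquation Ω T X U a n g a' n' g') {z : Var} (hz : z ∈ Ω) :
    fderiv ℝ T z et ≠ 0 := by
  intro h
  obtain ⟨⟨w1, w2, w3⟩, h1, -⟩ := H.surj z hz 1 0 0
  rw [clm_apply_eq, h, (fderiv_T_eq_zero H E hz).1, (fderiv_T_eq_zero H E hz).2] at h1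
  norm_num at h1

theorem total_deriv_X_sq (H : Nondegenerate Ω T X U)
    (E : MapsConstEquation Ω T X U a n g a' n' g') {z : Var} (hz : z ∈ Ω) (q : ℝ)
    (hs : fderiv ℝ X z ex + q * fderiv ℝ X z eu ≠ 0) :
    g * (fderiv ℝ X z ex + q * fderiv ℝ X z eu) ^ 2 = g' (T z) * fderiv ℝ T z et := by
  have hTt := fderiv_T_et_ne_zero H E hz
  obtain ⟨hTx, hTu⟩ := fderiv_T_eq_zero H E hz
  have hTT : fderiv ℝ (fderiv ℝ T) z (0, 1, q) (0, 1, q) = 0 := by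
    rw [clm_apply_eq (fderiv ℝ (fderiv ℝ T) z (0, 1, q)) 0 1 q,
      fderiv_fderiv_eq_zero H.isOpen H.smooth_T (fun z hz => (fderiv_T_eq_zero H E hz).1) hz,
      fderiv_fderiv_eq_zero H.isOpen H.smooth_T (fun z hz => (fderiv_T_eq_zero H E hz).2) hz]
    simp
  have hΔ : ∀ p : ℝ, (fderiv ℝ T z et + p * fderiv ℝ T z eu) *
      (fderiv ℝ X z ex + q * fderiv ℝ X z eu) -
      (fderiv ℝ T z ex + q * fderiv ℝ T z eu) * (fderiv ℝ X z et + p * fderiv ℝ X z eu) ≠ 0 := by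
    intro p
    rw [hTx, hTu]
    simpa using ⟨hTt, hs⟩
  set A := a * (n * z.2.2 ^ (n - 1) * q) with hA
  -- Two jets on the equation with the same `u_x`: raising `u_xx` from `0` to `1` is balanced by
  -- raising `u_t` by `g`.
  obtain ⟨ut, ux, uxx, i10, i01, i2, i3⟩ := exists_prolongation_coord H hz (-A) q 0 0 (hΔ _)
  obtain ⟨vt, vx, vxx, j10, j01, j2, j3⟩ := exists_prolongation_coord H hz (g - A) q 0 1 (hΔ _)
  have k1 := i3 _ _ _ _ _ _ E (by rw [← hA]; ring)
  have k2 := j3 _ _ _ _ _ _ E (by rw [← hA]; ring)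
  have i2' := i2 (0, 1) (0, 1, q) (by simp)
    (by rw [clm_apply_eq _ 0 1 q, hTx, hTu]; simp)
  have j2' := j2 (0, 1) (0, 1, q) (by simp)
    (by rw [clm_apply_eq _ 0 1 q, hTx, hTu]; simp)
  rw [hTT, clm_apply_eq (fderiv ℝ X z) 0 1 q] at i2' j2'
  simp only [hTx, hTu] at i10 i01 j10 j01 i2' j2'
  obtain ⟨⟨w1, w2, w3⟩, h1, h2, h3⟩ := H.surj z hz 0 0 1
  rw [clm_apply_eq] at h1 h2 h3
  rw [hTx, hTu] at h1
  have hw1 : w1 = 0 := (mul_eq_zero.1 (show w1 * _ = 0 by linear_combination h1)).resolve_right hTt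
  subst hw1
  have hux : ux = vx := by
    have := (mul_eq_zero.1 (show _ * (ux - vx) = 0 by
      linear_combination j01 - i01)).resolve_left hs
    linarith
  subst hux
  have e1 : fderiv ℝ U z eu - ux * fderiv ℝ X z eu =
      (vxx - uxx) * (fderiv ℝ X z ex + q * fderiv ℝ X z eu) ^ 2 := by
    linear_combination j2' - i2'
  have e2 : g * (fderiv ℝ U z eu - ux * fderiv ℝ X z eu) =
      g' (T z) * (vxx - uxx) * fderiv ℝ T z et := by
    linear_combination j10 - i10 + fderiv ℝ T z et * (k2 - k1)
  -- If the transformed `u_xx` did not change, then `U_u = ux * X_u`, and the differential of `U`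
  -- would again depend linearly on those of `T` and `X`.
  have hne : vxx - uxx ≠ 0 := by
    intro h0
    rw [h0, zero_mul] at e1
    have : (0 : ℝ) = 1 := by
      linear_combination h3 - ux * h2 - w2 * i01 - (w3 - q * w2) * e1
    exact zero_ne_one this
  refine mul_left_cancel₀ hne ?_
  linear_combination e2 - g * e1

/-- If `X_u ≠ 0`, a suitable slope gives `X_x + q X_u` any nonzero value `s`, while `g s²` would be
independent of `s`; the values `1` and `2` contradict this. -/
theorem fderiv_X_eu_eq_zero (H : Nondegenerate Ω T X U)
    (E : MapsConstEquation Ω T X U a n g a' n' g') {z : Var} (hz : z ∈ Ω) :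
    fderiv ℝ X z eu = 0 := by
  by_contra h
  have key : ∀ s : ℝ, s ≠ 0 → g * s ^ 2 = g' (T z) * fderiv ℝ T z et := by
    intro s hs
    have e : fderiv ℝ X z ex + (s - fderiv ℝ X z ex) / fderiv ℝ X z eu * fderiv ℝ X z eu = s := by
      rw [div_mul_cancel₀ _ h]; ring
    have := total_deriv_X_sq H E hz ((s - fderiv ℝ X z ex) / fderiv ℝ X z eu) (by rwa [e])
    rwa [e] at this
  have h1 := key 1 one_ne_zero
  have h2 := key 2 two_ne_zero
  exact E.g_ne (by linear_combination (h2 - h1) / 3)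

theorem fderiv_X_ex_ne_zero (H : Nondegenerate Ω T X U)
    (E : MapsConstEquation Ω T X U a n g a' n' g') {z : Var} (hz : z ∈ Ω) :
    fderiv ℝ X z ex ≠ 0 := by
  intro h
  obtain ⟨⟨w1, w2, w3⟩, h1, h2, -⟩ := H.surj z hz 0 1 0
  rw [clm_apply_eq] at h1 h2
  rw [(fderiv_T_eq_zero H E hz).1, (fderiv_T_eq_zero H E hz).2] at h1
  rw [h, fderiv_X_eu_eq_zero H E hz] at h2
  have hw1 : w1 = 0 := (mul_eq_zero.1 (show w1 * _ = 0 by linear_combination h1)).resolve_right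
    (fderiv_T_et_ne_zero H E hz)
  rw [hw1] at h2
  norm_num at h2

theorem fderiv_U_eu_ne_zero (H : Nondegenerate Ω T X U)
    (E : MapsConstEquation Ω T X U a n g a' n' g') {z : Var} (hz : z ∈ Ω) :
    fderiv ℝ U z eu ≠ 0 := by
  intro h
  obtain ⟨⟨w1, w2, w3⟩, h1, h2, h3⟩ := H.surj z hz 0 0 1
  rw [clm_apply_eq] at h1 h2 h3
  rw [(fderiv_T_eq_zero H E hz).1, (fderiv_T_eq_zero H E hz).2] at h1
  have hw1 : w1 = 0 := (mul_eq_zero.1 (show w1 * _ = 0 by linear_combination h1)).resolve_right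
    (fderiv_T_et_ne_zero H E hz)
  rw [fderiv_X_eu_eq_zero H E hz, hw1] at h2
  have hw2 : w2 = 0 := (mul_eq_zero.1 (show w2 * _ = 0 by linear_combination h2)).resolve_right
    (fderiv_X_ex_ne_zero H E hz)
  rw [h, hw1, hw2] at h3
  norm_num at h3

theorem g_mul_fderiv_X_sq (H : Nondegenerate Ω T X U)
    (E : MapsConstEquation Ω T X U a n g a' n' g') {z : Var} (hz : z ∈ Ω) :
    g * fderiv ℝ X z ex ^ 2 = g' (T z) * fderiv ℝ T z et := by
  have := total_deriv_X_sq H E hz 0 (by simpa using fderiv_X_ex_ne_zero H E hz)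
  simpa using this

/-- The identity obtained by splitting the determining equation with respect to `u_xx` and `u_t`. -/
theorem determining_identity (H : Nondegenerate Ω T X U)
    (E : MapsConstEquation Ω T X U a n g a' n' g') {z : Var} (hz : z ∈ Ω) (q : ℝ) :
    fderiv ℝ X z ex * (fderiv ℝ U z et - a * (n * z.2.2 ^ (n - 1)) * q * fderiv ℝ U z eu) +
      (fderiv ℝ T z et * a' * (n' * U z ^ (n' - 1)) - fderiv ℝ X z et +
        g * fderiv ℝ (fderiv ℝ X) z ex ex) * (fderiv ℝ U z ex + q * fderiv ℝ U z eu) =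
    g * fderiv ℝ X z ex * (fderiv ℝ (fderiv ℝ U) z ex ex +
      2 * q * fderiv ℝ (fderiv ℝ U) z ex eu + q ^ 2 * fderiv ℝ (fderiv ℝ U) z eu eu) := by
  have hTt := fderiv_T_et_ne_zero H E hz
  have hXx := fderiv_X_ex_ne_zero H E hz
  have hXu := fderiv_X_eu_eq_zero H E hz
  obtain ⟨hTx, hTu⟩ := fderiv_T_eq_zero H E hz
  have hgX := g_mul_fderiv_X_sq H E hz
  have nhds := H.isOpen.mem_nhds hz
  have hTT : fderiv ℝ (fderiv ℝ T) z (0, 1, q) (0, 1, q) = 0 := by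
    rw [clm_apply_eq (fderiv ℝ (fderiv ℝ T) z (0, 1, q)) 0 1 q,
      fderiv_fderiv_eq_zero H.isOpen H.smooth_T (fun z hz => (fderiv_T_eq_zero H E hz).1) hz,
      fderiv_fderiv_eq_zero H.isOpen H.smooth_T (fun z hz => (fderiv_T_eq_zero H E hz).2) hz]
    simp
  have hXX : fderiv ℝ (fderiv ℝ X) z (0, 1, q) (0, 1, q) = fderiv ℝ (fderiv ℝ X) z ex ex := by
    have h0 := fderiv_fderiv_eq_zero H.isOpen H.smooth_X
      (fun z hz => fderiv_X_eu_eq_zero H E hz) hz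
    rw [clm_apply₂_eq _ (fderiv_fderiv_comm (H.smooth_X.contDiffAt nhds) _ _), h0, h0]
    ring
  have hUU := clm_apply₂_eq (fderiv ℝ (fderiv ℝ U) z)
    (fderiv_fderiv_comm (H.smooth_U.contDiffAt nhds) _ _) q
  set A := a * (n * z.2.2 ^ (n - 1) * q) with hA
  have hΔ : (fderiv ℝ T z et + (-A) * fderiv ℝ T z eu) *
      (fderiv ℝ X z ex + q * fderiv ℝ X z eu) -
      (fderiv ℝ T z ex + q * fderiv ℝ T z eu) *
        (fderiv ℝ X z et + (-A) * fderiv ℝ X z eu) ≠ 0 := by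
    rw [hTx, hTu, hXu]
    simpa using ⟨hTt, hXx⟩
  -- The dependence on `u_xx` is already exhausted by `hgX`, so the jets with `u_xx = 0` suffice.
  obtain ⟨ut, ux, uxx, i10, i01, i2, i3⟩ := exists_prolongation_coord H hz (-A) q 0 0 hΔ
  have k1 := i3 _ _ _ _ _ _ E (by rw [← hA]; ring)
  have i2' := i2 (0, 1) (0, 1, q) (by simp)
    (by rw [clm_apply_eq _ 0 1 q, hTx, hTu]; simp)
  rw [hTT, hXX, hUU, clm_apply_eq (fderiv ℝ X z) 0 1 q] at i2'
  simp only [hTx, hTu, hXu] at i10 i01 i2'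
  rw [hA] at i10
  generalize fderiv ℝ (fderiv ℝ U) z ex ex = Uxx at *
  generalize fderiv ℝ (fderiv ℝ U) z ex eu = Uxu at *
  generalize fderiv ℝ (fderiv ℝ U) z eu eu = Uuu at *
  generalize fderiv ℝ (fderiv ℝ X) z ex ex = Xxx at *
  generalize fderiv ℝ T z et = Tt at *
  generalize fderiv ℝ X z et = Xt at *
  generalize fderiv ℝ X z ex = Xx at *
  generalize fderiv ℝ U z et = Ut at *
  generalize fderiv ℝ U z ex = Ux at *
  generalize fderiv ℝ U z eu = Uu at *
  linear_combination Xx * i10 + (Tt * a' * (n' * U z ^ (n' - 1)) - Xt + g * Xxx) * i01 +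
    Tt * Xx * k1 - Xx * uxx * hgX - g * Xx * i2'

end Steps

/-! ### Translations along an axis and comparison of powers. -/

/-- The order of the quantifiers matters: for a fixed small shift the equality holds on a whole
neighbourhood, so that it can be differentiated in `y`. -/
theorem eventually_translate_eq {Ω : Set Var} (hΩ : IsOpen Ω) {W : Var → ℝ}
    (hW : DifferentiableOn ℝ W Ω) {e : Var} (h : ∀ z ∈ Ω, fderiv ℝ W z e = 0) {z : Var}
    (hz : z ∈ Ω) : ∀ᶠ s : ℝ in 𝓝 0, ∀ᶠ y in 𝓝 z, W (y + s • e) = W y := by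
  have hc : Tendsto (fun m : Var × ℝ => m.1 + m.2 • e) (𝓝 (z, 0)) (𝓝 z) := by
    have : Continuous fun m : Var × ℝ => m.1 + m.2 • e := by fun_prop
    simpa using this.tendsto (z, 0)
  have hc' := hc.eventually (hΩ.mem_nhds hz)
  rw [nhds_prod_eq, eventually_prod_iff] at hc'
  obtain ⟨pa, ha, pb, hb, hab⟩ := hc'
  obtain ⟨ε, hε, hball⟩ := Metric.eventually_nhds_iff_ball.1 hb
  filter_upwards [Metric.ball_mem_nhds 0 hε] with s hs
  filter_upwards [ha] with y hy
  have hd : ∀ r ∈ Metric.ball (0 : ℝ) ε, HasDerivAt (fun r : ℝ => W (y + r • e)) 0 r := by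
    intro r hr
    have hmem : y + r • e ∈ Ω := hab hy (hball r hr)
    have h1 : HasDerivAt (fun r : ℝ => y + r • e) e r := by
      simpa using ((hasDerivAt_id r).smul_const e).const_add y
    have h2 := (hW.differentiableAt (hΩ.mem_nhds hmem)).hasFDerivAt.comp_hasDerivAt r h1
    rwa [h _ hmem] at h2
  have := Metric.isOpen_ball.is_const_of_deriv_eq_zero
    (convex_ball (0 : ℝ) ε).isPreconnected
    (fun r hr => (hd r hr).differentiableAt.differentiableWithinAt)
    (fun r hr => (hd r hr).deriv) hs (Metric.mem_ball_self hε)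
  simpa using this

theorem fderiv_translate {W : Var → ℝ} {z e : Var} {s : ℝ}
    (h : ∀ᶠ y in 𝓝 z, W (y + s • e) = W y) : fderiv ℝ W (z + s • e) = fderiv ℝ W z := by
  have h' : (fun y => W (y + s • e)) =ᶠ[𝓝 z] W := h
  rw [← h'.fderiv_eq, fderiv_comp_add_right]

theorem eventually_add_mul_ne_zero (c y : ℝ) {m : ℝ} (hm : m ≠ 0) :
    ∀ᶠ s in 𝓝[≠] y, c + m * s ≠ 0 := by
  have h : ∀ᶠ s in 𝓝[≠] y, s ≠ -c / m := by
    by_cases hy : y = -c / m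
    · rw [← hy]; exact self_mem_nhdsWithin
    · exact eventually_nhdsWithin_of_eventually_nhds (isOpen_ne.mem_nhds hy)
  filter_upwards [h] with s hs h0
  apply hs
  field_simp
  linarith

/-- An affine function vanishing near a point, except possibly at that point, is zero. -/
theorem eq_zero_of_eventually_affine {A B y : ℝ} (h : ∀ᶠ s in 𝓝[≠] y, A + B * s = 0) :
    A = 0 ∧ B = 0 := by
  by_cases hB : B = 0
  · obtain ⟨s, hs⟩ := h.exists
    exact ⟨by simpa [hB] using hs, hB⟩
  · obtain ⟨s, h1, h2⟩ := (h.and (eventually_add_mul_ne_zero A y hB)).exists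
    exact absurd h1 h2

/-- Eliminating the powers between the first and second derivatives of the relation leaves `(k - 1)
m s = (l - 1) (c + m s)`, an affine identity in `s`. Hence `k = l` and `(l - 1) c = 0`. For `l ≠ 1`
the value and the first derivative at `y` then give `S = 0`; for `l = 1` both sides are affine and
are compared directly. -/
theorem power_eq_power {α β c m y k l S : ℝ} (hα : α ≠ 0) (hβ : β ≠ 0) (hm : m ≠ 0)
    (hy : y ≠ 0) (hk : k ≠ 0) (hl : l ≠ 0)
    (hint : 0 < y ∨ ∃ j : ℤ, l = j)
    (h : ∀ᶠ s in 𝓝 y, α * (c + m * s) ^ k = β * s ^ l + S) :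
    k = l ∧ (l ≠ 1 → c = 0 ∧ S = 0) ∧ (l = 1 → S * m = β * c) := by
  have hlin : ∀ s : ℝ, HasDerivAt (fun s : ℝ => c + m * s) m s := by
    intro s
    simpa using ((hasDerivAt_id s).const_mul m).const_add c
  have hpow : ∀ (κ s : ℝ), c + m * s ≠ 0 →
      HasDerivAt (fun s : ℝ => (c + m * s) ^ κ) (κ * (c + m * s) ^ (κ - 1) * m) s := by
    intro κ s hs
    exact (Real.hasDerivAt_rpow_const (.inl hs)).comp s (hlin s)
  have h1 : ∀ᶠ s in 𝓝 y, c + m * s ≠ 0 → s ≠ 0 →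
      α * (k * (c + m * s) ^ (k - 1) * m) = β * (l * s ^ (l - 1)) := by
    filter_upwards [h.eventually_nhds] with s hs h0 hs0
    have e : (fun s => α * (c + m * s) ^ k) =ᶠ[𝓝 s] fun s => β * s ^ l + S := hs
    have d1 := ((hpow k s h0).const_mul α).deriv
    have d2 := (((Real.hasDerivAt_rpow_const (p := l) (.inl hs0)).const_mul β).add_const S).deriv
    rw [← d1, e.deriv_eq, d2]
  have h2 : ∀ᶠ s in 𝓝 y, c + m * s ≠ 0 → s ≠ 0 →
      α * (k * ((k - 1) * (c + m * s) ^ (k - 1 - 1) * m) * m) =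
        β * (l * ((l - 1) * s ^ (l - 1 - 1))) := by
    filter_upwards [h1.eventually_nhds] with s hs h0 hs0
    have e : (fun s => α * (k * (c + m * s) ^ (k - 1) * m)) =ᶠ[𝓝 s]
        fun s => β * (l * s ^ (l - 1)) := by
      filter_upwards [hs, (hlin s).continuousAt.eventually_ne h0,
        continuousAt_id.eventually_ne hs0] with r hr hr1 hr2 using hr hr1 hr2
    have d1 := ((((hpow (k - 1) s h0).const_mul k).mul_const m).const_mul α).deriv
    have d2 := (((Real.hasDerivAt_rpow_const (p := l - 1) (.inl hs0)).const_mul l).const_mul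
      β).deriv
    rw [← d1, e.deriv_eq, d2]
  have hy0 : ∀ᶠ s in 𝓝[≠] y, s ≠ 0 :=
    eventually_nhdsWithin_of_eventually_nhds (isOpen_ne.mem_nhds hy)
  have hR : ∀ᶠ s in 𝓝[≠] y, s ^ (l - 1) ≠ 0 := by
    -- With a negative base and a non-integer exponent, the real power carries a cosine factor and
    -- could vanish; `hint` excludes this case.
    rcases hint with hpos | ⟨j, rfl⟩
    · filter_upwards [eventually_nhdsWithin_of_eventually_nhds (lt_mem_nhds hpos)] with s hs
      exact (Real.rpow_pos_of_pos hs _).ne'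
    · filter_upwards [hy0] with s hs
      have : ((j : ℝ) - 1) = ((j - 1 : ℤ) : ℝ) := by push_cast; rfl
      rw [this, Real.rpow_intCast]
      exact zpow_ne_zero _ hs
  have h3 : ∀ᶠ s in 𝓝[≠] y, (-((l - 1) * c)) + ((k - l) * m) * s = 0 := by
    filter_upwards [eventually_nhdsWithin_of_eventually_nhds h1,
      eventually_nhdsWithin_of_eventually_nhds h2, eventually_add_mul_ne_zero c y hm, hy0, hR]
      with s s1 s2 s3 s4 hRs
    have e1 := s1 s3 s4
    have e2 := s2 s3 s4
    rw [Real.rpow_sub_one s3, Real.rpow_sub_one s4] at e2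
    have e3 : (k - 1) * m * s * (β * (l * s ^ (l - 1))) =
        (l - 1) * (c + m * s) * (β * (l * s ^ (l - 1))) := by
      have e4 : (c + m * s) * s *
          (α * (k * ((k - 1) * ((c + m * s) ^ (k - 1) / (c + m * s)) * m) * m)) =
          (c + m * s) * s * (β * (l * ((l - 1) * (s ^ (l - 1) / s)))) := by rw [e2]
      have e5 : (c + m * s) * s *
          (α * (k * ((k - 1) * ((c + m * s) ^ (k - 1) / (c + m * s)) * m) * m)) =
          (k - 1) * m * s * (α * (k * (c + m * s) ^ (k - 1) * m)) := by field_simp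
      have e6 : (c + m * s) * s * (β * (l * ((l - 1) * (s ^ (l - 1) / s)))) =
          (l - 1) * (c + m * s) * (β * (l * s ^ (l - 1))) := by field_simp
      rw [e5, e6, e1] at e4
      exact e4
    have e7 := mul_right_cancel₀ (mul_ne_zero hβ (mul_ne_zero hl hRs)) e3
    linear_combination e7
  obtain ⟨c0, kl⟩ := eq_zero_of_eventually_affine h3
  have hkl : k = l := by
    have := (mul_eq_zero.1 kl).resolve_right hm
    linarith
  subst hkl
  refine ⟨rfl, fun hk1 => ?_, fun hk1 => ?_⟩
  · have hc : c = 0 := by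
      have := neg_eq_zero.1 c0
      exact (mul_eq_zero.1 this).resolve_left (sub_ne_zero.2 hk1)
    subst hc
    refine ⟨rfl, ?_⟩
    have hmy : m * y ≠ 0 := mul_ne_zero hm hy
    have e0 := h.self_of_nhds
    have e1 := h1.self_of_nhds (by simpa using hmy) hy
    simp only [zero_add] at e0 e1
    rw [Real.rpow_sub_one hmy, Real.rpow_sub_one hy] at e1
    field_simp at e1
    linarith
  · subst hk1
    have h4 : ∀ᶠ s in 𝓝[≠] y, (α * c - S) + (α * m - β) * s = 0 := by
      filter_upwards [eventually_nhdsWithin_of_eventually_nhds h] with s hs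
      rw [Real.rpow_one, Real.rpow_one] at hs
      linarith
    obtain ⟨a1, a2⟩ := eq_zero_of_eventually_affine h4
    linear_combination c * a2 - m * a1

/-! ### Determining equations, split in `u_x` and in the arbitrary elements. -/

section Determining

variable {Ω : Set Var} {T X U : Var → ℝ} {a n g a' n' : ℝ} {g' : ℝ → ℝ}

/-- The determining identity is quadratic in `q`, so its values at `0`, `1`, `-1` isolate the
coefficients. In the third relation the coefficient of `U_x` has been eliminated by means of the
second. -/
theorem determining_equations (H : Nondegenerate Ω T X U)
    (E : MapsConstEquation Ω T X U a n g a' n' g') {z : Var} (hz : z ∈ Ω) :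
    fderiv ℝ (fderiv ℝ U) z eu eu = 0 ∧
    (fderiv ℝ T z et * a' * (n' * U z ^ (n' - 1)) - fderiv ℝ X z et +
        g * fderiv ℝ (fderiv ℝ X) z ex ex) * fderiv ℝ U z eu =
      fderiv ℝ X z ex * (a * (n * z.2.2 ^ (n - 1)) * fderiv ℝ U z eu +
        2 * g * fderiv ℝ (fderiv ℝ U) z ex eu) ∧
    fderiv ℝ U z eu * fderiv ℝ U z et + fderiv ℝ U z ex *
      (a * (n * z.2.2 ^ (n - 1)) * fderiv ℝ U z eu + 2 * g * fderiv ℝ (fderiv ℝ U) z ex eu) =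
      g * fderiv ℝ (fderiv ℝ U) z ex ex * fderiv ℝ U z eu := by
  have hXx := fderiv_X_ex_ne_zero H E hz
  have h0 := determining_identity H E hz 0
  have h1 := determining_identity H E hz 1
  have h2 := determining_identity H E hz (-1)
  have hK : (fderiv ℝ T z et * a' * (n' * U z ^ (n' - 1)) - fderiv ℝ X z et +
        g * fderiv ℝ (fderiv ℝ X) z ex ex) * fderiv ℝ U z eu =
      fderiv ℝ X z ex * (a * (n * z.2.2 ^ (n - 1)) * fderiv ℝ U z eu +
        2 * g * fderiv ℝ (fderiv ℝ U) z ex eu) := by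
    linear_combination (h1 - h2) / 2
  refine ⟨?_, hK, ?_⟩
  · refine mul_left_cancel₀ (mul_ne_zero E.g_ne hXx) ?_
    linear_combination -(h1 + h2) / 2 + h0
  · refine mul_left_cancel₀ hXx ?_
    linear_combination fderiv ℝ U z eu * h0 - fderiv ℝ U z ex * hK

/-- Every equation with the exponent `n` and constant `g` is mapped to an equation. -/
def MapsAllConst (Ω : Set Var) (T X U : Var → ℝ) (n : ℝ) : Prop :=
  ∀ a g : ℝ, a ≠ 0 → g ≠ 0 → ∃ a' n' g', MapsConstEquation Ω T X U a n g a' n' g'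

/-- In the third determining equation only the term `U_x a n u^(n-1) U_u` involves `a`; neither `a'`
nor `g'` occurs. Subtracting the cases `a = 1` and `a = 2` isolates it. -/
theorem fderiv_U_ex_eq_zero (H : Nondegenerate Ω T X U) (A : MapsAllConst Ω T X U n)
    {z : Var} (hz : z ∈ Ω) (hu : z.2.2 ≠ 0) : fderiv ℝ U z ex = 0 := by
  obtain ⟨_, _, _, E1⟩ := A 1 1 one_ne_zero one_ne_zero
  obtain ⟨_, _, _, E2⟩ := A 2 1 two_ne_zero one_ne_zero
  have h1 := (determining_equations H E1 hz).2.2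
  have h2 := (determining_equations H E2 hz).2.2
  have hUu := fderiv_U_eu_ne_zero H E1 hz
  have hp : z.2.2 ^ (n - 1) ≠ 0 := by
    rcases E1.pow z hz with h | ⟨h, k, rfl⟩ | ⟨h, -⟩
    · exact (Real.rpow_pos_of_pos h _).ne'
    · have : ((k : ℝ) - 1) = ((k - 1 : ℤ) : ℝ) := by push_cast; rfl
      rw [this, Real.rpow_intCast]
      exact zpow_ne_zero _ hu
    · exact absurd h hu
  refine (mul_eq_zero.1 (show fderiv ℝ U z ex * (n * z.2.2 ^ (n - 1) * fderiv ℝ U z eu) = 0 by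
    linear_combination h2 - h1)).resolve_right ?_
  exact mul_ne_zero (mul_ne_zero E1.n_ne_zero hp) hUu

theorem isOpen_inter_u_ne_zero (hΩ : IsOpen Ω) : IsOpen (Ω ∩ {z : Var | z.2.2 ≠ 0}) :=
  hΩ.inter (isOpen_ne.preimage (continuous_snd.comp continuous_snd))

/-- A continuous function on an open set of points `(t, x, u)` is zero if it is zero for `u ≠ 0`. -/
theorem eq_zero_of_u_ne_zero (hΩ : IsOpen Ω) {F : Var → ℝ} (hF : ContinuousOn F Ω)
    (h : ∀ z ∈ Ω, z.2.2 ≠ 0 → F z = 0) {z : Var} (hz : z ∈ Ω) : F z = 0 := by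
  have hc : Tendsto (fun s : ℝ => z + s • eu) (𝓝[≠] 0) (𝓝 z) := by
    have : Continuous fun s : ℝ => z + s • eu := by fun_prop
    have := this.tendsto 0
    simp only [zero_smul, add_zero] at this
    exact this.mono_left nhdsWithin_le_nhds
  have h1 := ((hF.continuousAt (hΩ.mem_nhds hz)).tendsto.comp hc)
  have h2 : (F ∘ fun s : ℝ => z + s • eu) =ᶠ[𝓝[≠] 0] fun _ => 0 := by
    filter_upwards [hc.eventually (hΩ.mem_nhds hz),
      eventually_add_mul_ne_zero z.2.2 0 (one_ne_zero (α := ℝ))] with s hs hs'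
    exact h _ hs (by simpa using hs')
  exact tendsto_nhds_unique (h1.congr' h2) tendsto_const_nhds |>.symm ▸ rfl

theorem fderiv_U_et_eq_zero (H : Nondegenerate Ω T X U) (A : MapsAllConst Ω T X U n)
    {z : Var} (hz : z ∈ Ω) (hu : z.2.2 ≠ 0) :
    fderiv ℝ U z et = 0 ∧ fderiv ℝ (fderiv ℝ U) z ex eu = 0 := by
  have hO := isOpen_inter_u_ne_zero H.isOpen
  obtain ⟨_, _, _, E⟩ := A 1 1 one_ne_zero one_ne_zero
  have h0 : ∀ v, fderiv ℝ (fderiv ℝ U) z v ex = 0 := fun v =>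
    fderiv_fderiv_eq_zero hO (H.smooth_U.mono inter_subset_left)
      (fun y hy => fderiv_U_ex_eq_zero H A hy.1 hy.2) ⟨hz, hu⟩ v
  have hs := fderiv_fderiv_comm (H.smooth_U.contDiffAt (H.isOpen.mem_nhds hz)) eu ex
  have h1 := (determining_equations H E hz).2.2
  rw [h0, fderiv_U_ex_eq_zero H A hz hu] at h1
  refine ⟨?_, hs ▸ h0 eu⟩
  refine (mul_eq_zero.1 (show fderiv ℝ U z eu * _ = 0 by
    linear_combination h1)).resolve_left (fderiv_U_eu_ne_zero H E hz)

theorem power_equation (H : Nondegenerate Ω T X U) (A : MapsAllConst Ω T X U n)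
    (E : MapsConstEquation Ω T X U a n g a' n' g') {z : Var} (hz : z ∈ Ω) (hu : z.2.2 ≠ 0) :
    fderiv ℝ T z et * a' * n' * U z ^ (n' - 1) =
      a * n * fderiv ℝ X z ex * z.2.2 ^ (n - 1) +
        (fderiv ℝ X z et - g * fderiv ℝ (fderiv ℝ X) z ex ex) := by
  have h := (determining_equations H E hz).2.1
  rw [(fderiv_U_et_eq_zero H A hz hu).2] at h
  refine mul_right_cancel₀ (fderiv_U_eu_ne_zero H E hz) ?_
  linear_combination h

/-- The conclusions about powers that follow by moving along the `u`-axis. -/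
theorem power_consequences (H : Nondegenerate Ω T X U) (A : MapsAllConst Ω T X U n)
    (E : MapsConstEquation Ω T X U a n g a' n' g') {z : Var} (hz : z ∈ Ω) (hu : z.2.2 ≠ 0) :
    n' = n ∧
    (n ≠ 2 → U z - fderiv ℝ U z eu * z.2.2 = 0 ∧
      fderiv ℝ X z et - g * fderiv ℝ (fderiv ℝ X) z ex ex = 0) ∧
    (n = 2 → (fderiv ℝ X z et - g * fderiv ℝ (fderiv ℝ X) z ex ex) * fderiv ℝ U z eu =
      a * n * fderiv ℝ X z ex * (U z - fderiv ℝ U z eu * z.2.2)) := by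
  have hΩ := H.isOpen
  have tT := eventually_translate_eq hΩ (H.smooth_T.differentiableOn (by simp))
    (fun z hz => (fderiv_T_eq_zero H E hz).2) hz
  have tX := eventually_translate_eq hΩ (H.smooth_X.differentiableOn (by simp))
    (fun z hz => fderiv_X_eu_eq_zero H E hz) hz
  have hUu := contDiffOn_fderiv_apply hΩ H.smooth_U eu
  have dUu : ∀ y ∈ Ω, fderiv ℝ (fun y => fderiv ℝ U y eu) y eu = 0 := fun y hy => by
    rw [fderiv_fderiv_apply (H.smooth_U.contDiffAt (hΩ.mem_nhds hy))]
    exact (determining_equations H E hy).1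
  have tUu := eventually_translate_eq hΩ (hUu.differentiableOn (by simp)) dUu hz
  have hC : ContDiffOn ℝ ∞ (fun y : Var => U y - fderiv ℝ U y eu * y.2.2) Ω :=
    H.smooth_U.sub (hUu.mul (by fun_prop))
  -- Since `U_uu = 0`, `U` is affine in `u`; its intercept `U - U_u u` does not change along the
  -- `u`-axis.
  have tC := eventually_translate_eq (e := eu) hΩ (hC.differentiableOn (by simp)) (fun y hy => by
    have h1 := ((H.smooth_U.contDiffAt (hΩ.mem_nhds hy)).differentiableAt (by simp)).hasFDerivAt
    have h2 := ((hUu.contDiffAt (hΩ.mem_nhds hy)).differentiableAt (by simp)).hasFDerivAt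
    have h3 : HasFDerivAt (fun y : Var => y.2.2)
      ((ContinuousLinearMap.snd ℝ ℝ ℝ).comp (ContinuousLinearMap.snd ℝ ℝ (ℝ × ℝ))) y :=
      ((ContinuousLinearMap.snd ℝ ℝ ℝ).comp
        (ContinuousLinearMap.snd ℝ ℝ (ℝ × ℝ))).hasFDerivAt
    have h4 := (h1.fun_sub (h2.fun_mul h3)).fderiv
    rw [h4]
    simp [dUu y hy]) hz
  have hcont : Tendsto (fun s : ℝ => z + s • eu) (𝓝 0) (𝓝 z) := by
    have : Continuous fun s : ℝ => z + s • eu := by fun_prop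
    simpa using this.tendsto 0
  have hO := (isOpen_inter_u_ne_zero hΩ).mem_nhds ⟨hz, hu⟩
  have key : ∀ᶠ s : ℝ in 𝓝 0, fderiv ℝ T z et * a' * n' *
      ((U z - fderiv ℝ U z eu * z.2.2) + fderiv ℝ U z eu * (z.2.2 + s)) ^ (n' - 1) =
      a * n * fderiv ℝ X z ex * (z.2.2 + s) ^ (n - 1) +
        (fderiv ℝ X z et - g * fderiv ℝ (fderiv ℝ X) z ex ex) := by
    filter_upwards [tT, tX, tUu, tC, hcont.eventually hO] with s sT sX sU sC sO
    have e := power_equation H A E sO.1 sO.2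
    have sX2 : ∀ᶠ y in 𝓝 z, fderiv ℝ X (y + s • eu) = fderiv ℝ X y := by
      filter_upwards [sX.eventually_nhds] with y hy using fderiv_translate hy
    have sX2' : fderiv ℝ (fderiv ℝ X) (z + s • eu) = fderiv ℝ (fderiv ℝ X) z := by
      have h' : (fun y => fderiv ℝ X (y + s • eu)) =ᶠ[𝓝 z] fderiv ℝ X := sX2
      rw [← h'.fderiv_eq, fderiv_comp_add_right]
    have sU' := sU.self_of_nhds
    have sC' := sC.self_of_nhds
    have hs : (z + s • eu).2.2 = z.2.2 + s := by simp
    rw [fderiv_translate sT, fderiv_translate sX, sX2', hs] at e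
    rw [hs, sU'] at sC'
    rw [← e, ← sC']
    congr 2
    ring
  have hsub : Tendsto (fun y : ℝ => y - z.2.2) (𝓝 z.2.2) (𝓝 0) := by
    have : Continuous fun y : ℝ => y - z.2.2 := by fun_prop
    simpa using this.tendsto z.2.2
  have key' := hsub.eventually key
  simp only [add_sub_cancel] at key'
  -- Applied with `k = n' - 1`, `l = n - 1`, so the exceptional case `l = 1` is `n = 2`.
  have := power_eq_power
    (mul_ne_zero (mul_ne_zero (fderiv_T_et_ne_zero H E hz) E.a'_ne) E.n'_ne_zero)
    (mul_ne_zero (mul_ne_zero E.a_ne E.n_ne_zero) (fderiv_X_ex_ne_zero H E hz))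
    (fderiv_U_eu_ne_zero H E hz) hu (sub_ne_zero.2 E.n'_ne_one) (sub_ne_zero.2 E.n_ne_one)
    (by
      rcases E.pow z hz with h | ⟨-, k, rfl⟩ | ⟨h, -⟩
      · exact .inl h
      · exact .inr ⟨k - 1, by push_cast; rfl⟩
      · exact absurd h hu) key'
  obtain ⟨r1, r2, r3⟩ := this
  refine ⟨by linarith, fun h => r2 (fun h' => h (by linarith)), fun h => r3 (by linarith)⟩

theorem scaling_form (H : Nondegenerate Ω T X U) (A : MapsAllConst Ω T X U n)
    {z : Var} (hz : z ∈ Ω) (hu : z.2.2 ≠ 0) :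
    U z - fderiv ℝ U z eu * z.2.2 = 0 ∧ fderiv ℝ X z et = 0 ∧
      fderiv ℝ (fderiv ℝ X) z ex ex = 0 := by
  obtain ⟨_, _, _, E1⟩ := A 1 1 one_ne_zero one_ne_zero
  obtain ⟨_, _, _, E2⟩ := A 2 1 two_ne_zero one_ne_zero
  obtain ⟨_, _, _, E3⟩ := A 1 2 one_ne_zero two_ne_zero
  obtain ⟨-, p1, q1⟩ := power_consequences H A E1 hz hu
  obtain ⟨-, p2, q2⟩ := power_consequences H A E2 hz hu
  obtain ⟨-, p3, q3⟩ := power_consequences H A E3 hz hu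
  have hUu := fderiv_U_eu_ne_zero H E1 hz
  have hXx := fderiv_X_ex_ne_zero H E1 hz
  by_cases hn : n = 2
  · have s1 := q1 hn
    have s2 := q2 hn
    have s3 := q3 hn
    -- For `n = 2` the left side of the relation does not involve `a`, while the right side is
    -- proportional to it.
    have hC : U z - fderiv ℝ U z eu * z.2.2 = 0 :=
      (mul_eq_zero.1 (show n * fderiv ℝ X z ex * (U z - fderiv ℝ U z eu * z.2.2) = 0 by
        linear_combination s1 - s2)).resolve_left (mul_ne_zero E1.n_ne_zero hXx)
    rw [hC, mul_zero] at s1 s3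
    have t1 := (mul_eq_zero.1 s1).resolve_right hUu
    have t3 := (mul_eq_zero.1 s3).resolve_right hUu
    exact ⟨hC, by linarith, by linarith⟩
  · have t1 := (p1 hn).2
    have t3 := (p3 hn).2
    exact ⟨(p1 hn).1, by linarith, by linarith⟩

/-- The transformation of the coefficient `a`. -/
theorem coefficient_relation (H : Nondegenerate Ω T X U) (A : MapsAllConst Ω T X U n)
    (E : MapsConstEquation Ω T X U a n g a' n' g') {z : Var} (hz : z ∈ Ω) (hu : z.2.2 ≠ 0) :
    fderiv ℝ T z et * a' * fderiv ℝ U z eu ^ (n - 1) = a * fderiv ℝ X z ex := by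
  obtain ⟨hC, hXt, hXxx⟩ := scaling_form H A hz hu
  have hn := (power_consequences H A E hz hu).1
  have hp := power_equation H A E hz hu
  have hU : U z = fderiv ℝ U z eu * z.2.2 := by linarith
  rw [hXt, hXxx, hn, hU] at hp
  have hpow : (fderiv ℝ U z eu * z.2.2) ^ (n - 1) =
      fderiv ℝ U z eu ^ (n - 1) * z.2.2 ^ (n - 1) ∧ z.2.2 ^ (n - 1) ≠ 0 := by
    have hint : (∃ k : ℤ, n = k) → (fderiv ℝ U z eu * z.2.2) ^ (n - 1) =
        fderiv ℝ U z eu ^ (n - 1) * z.2.2 ^ (n - 1) ∧ z.2.2 ^ (n - 1) ≠ 0 := by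
      rintro ⟨k, rfl⟩
      have : ((k : ℝ) - 1) = ((k - 1 : ℤ) : ℝ) := by push_cast; rfl
      rw [this, Real.rpow_intCast, Real.rpow_intCast, Real.rpow_intCast]
      exact ⟨mul_zpow _ _ _, zpow_ne_zero _ hu⟩
    rcases E.pow z hz with h | ⟨-, hk⟩ | ⟨h, -⟩
    · have hUp := E.pow' z hz
      rw [hn] at hUp
      rcases hUp with h' | ⟨-, hk⟩ | ⟨-, k, hk⟩
      · rw [hU] at h'
        have hm : 0 < fderiv ℝ U z eu := pos_of_mul_pos_left h' h.le
        -- Positivity of both `u` and `U` makes the factor `U_u` positive, so the power of the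
        -- product splits even for a non-integer exponent.
        exact ⟨Real.mul_rpow hm.le h.le, (Real.rpow_pos_of_pos h _).ne'⟩
      · exact hint hk
      · exact hint ⟨k, by exact_mod_cast hk⟩
    · exact hint hk
    · exact absurd h hu
  rw [hpow.1] at hp
  refine mul_right_cancel₀ (mul_ne_zero E.n_ne_zero hpow.2) ?_
  linear_combination hp

end Determining

/-! ### Integration over the connected domain. -/

theorem clm_eq_zero {L : Var →L[ℝ] ℝ} (h1 : L et = 0) (h2 : L ex = 0) (h3 : L eu = 0) : L = 0 := by
  refine ContinuousLinearMap.ext fun v => ?_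
  rw [clm_apply_eq L v.1 v.2.1 v.2.2, h1, h2, h3]
  simp

theorem exists_eq_add_const {Ω : Set Var} (hΩ : IsOpen Ω) (hc : IsConnected Ω) {W : Var → ℝ}
    (hW : ContDiffOn ℝ ∞ W Ω) (L : Var →L[ℝ] ℝ) (h : ∀ z ∈ Ω, fderiv ℝ W z = L) :
    ∃ c, ∀ z ∈ Ω, W z = L z + c := by
  have hd : ∀ z ∈ Ω, HasFDerivAt (fun z => W z - L z) (0 : Var →L[ℝ] ℝ) z := by
    intro z hz
    have h1 := ((hW.contDiffAt (hΩ.mem_nhds hz)).differentiableAt (by simp)).hasFDerivAt.sub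
      L.hasFDerivAt
    rwa [h z hz, sub_self] at h1
  obtain ⟨z0, hz0⟩ := hc.nonempty
  refine ⟨W z0 - L z0, fun z hz => ?_⟩
  have := hΩ.is_const_of_fderiv_eq_zero (𝕜 := ℝ) hc.isPreconnected
    (fun z hz => (hd z hz).differentiableAt.differentiableWithinAt)
    (fun z hz => (hd z hz).fderiv) hz hz0
  linarith

theorem exists_eq_const {Ω : Set Var} (hΩ : IsOpen Ω) (hc : IsConnected Ω) {W : Var → ℝ}
    (hW : ContDiffOn ℝ ∞ W Ω) (h : ∀ z ∈ Ω, fderiv ℝ W z = 0) : ∃ c, ∀ z ∈ Ω, W z = c := by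
  obtain ⟨c, hc⟩ := exists_eq_add_const hΩ hc hW 0 h
  exact ⟨c, fun z hz => by simpa using hc z hz⟩

theorem fderiv_fderiv_apply_eq_zero {Ω : Set Var} (hΩ : IsOpen Ω) {W : Var → ℝ}
    (hW : ContDiffOn ℝ ∞ W Ω) {e : Var} {z : Var} (hz : z ∈ Ω)
    (h1 : fderiv ℝ (fderiv ℝ W) z et e = 0) (h2 : fderiv ℝ (fderiv ℝ W) z ex e = 0)
    (h3 : fderiv ℝ (fderiv ℝ W) z eu e = 0) : fderiv ℝ (fun y => fderiv ℝ W y e) z = 0 := by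
  have hz' := hW.contDiffAt (hΩ.mem_nhds hz)
  apply clm_eq_zero <;> rw [fderiv_fderiv_apply hz'] <;> assumption

section Global

variable {Ω : Set Var} {T X U : Var → ℝ} {n : ℝ}

/-- The pointwise relations extend to `u = 0` by continuity. Constancy of `T_t` comes from the
transformation of `a`: for `a = 1` it reads `T_t a' δ₅^(n-1) = δ₃`, where `a'` is a constant of the
target equation. -/
theorem exists_scaling_form (H : Nondegenerate Ω T X U) (hc : IsConnected Ω)
    (A : MapsAllConst Ω T X U n) :
    ∃ δ₁ δ₂ δ₃ δ₄ δ₅ : ℝ, δ₁ * δ₃ * δ₅ ≠ 0 ∧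
      ∀ z ∈ Ω, T z = δ₁ * z.1 + δ₂ ∧ X z = δ₃ * z.2.1 + δ₄ ∧ U z = δ₅ * z.2.2 ∧
        fderiv ℝ T z et = δ₁ ∧ fderiv ℝ X z ex = δ₃ ∧ fderiv ℝ U z eu = δ₅ := by
  have hΩ := H.isOpen
  obtain ⟨a', n', g', E⟩ := A 1 1 one_ne_zero one_ne_zero
  have Xt : ∀ z ∈ Ω, fderiv ℝ X z et = 0 := fun z hz =>
    eq_zero_of_u_ne_zero hΩ (contDiffOn_fderiv_apply hΩ H.smooth_X et).continuousOn
      (fun z hz hu => (scaling_form H A hz hu).2.1) hz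
  have Xu : ∀ z ∈ Ω, fderiv ℝ X z eu = 0 := fun z hz => fderiv_X_eu_eq_zero H E hz
  have Xxx : ∀ z ∈ Ω, fderiv ℝ (fderiv ℝ X) z ex ex = 0 := fun z hz => by
    refine eq_zero_of_u_ne_zero (F := fun z => fderiv ℝ (fderiv ℝ X) z ex ex) hΩ ?_
      (fun z hz hu => (scaling_form H A hz hu).2.2) hz
    exact (contDiffOn_fderiv_apply hΩ (contDiffOn_fderiv_apply hΩ H.smooth_X ex)
      ex).continuousOn.congr
      fun z hz => (fderiv_fderiv_apply (H.smooth_X.contDiffAt (hΩ.mem_nhds hz)) ex ex).symm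
  have Ut : ∀ z ∈ Ω, fderiv ℝ U z et = 0 := fun z hz =>
    eq_zero_of_u_ne_zero hΩ (contDiffOn_fderiv_apply hΩ H.smooth_U et).continuousOn
      (fun z hz hu => (fderiv_U_et_eq_zero H A hz hu).1) hz
  have Ux : ∀ z ∈ Ω, fderiv ℝ U z ex = 0 := fun z hz =>
    eq_zero_of_u_ne_zero hΩ (contDiffOn_fderiv_apply hΩ H.smooth_U ex).continuousOn
      (fun z hz hu => fderiv_U_ex_eq_zero H A hz hu) hz
  have hXs := contDiffOn_fderiv_apply hΩ H.smooth_X ex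
  have hUs := contDiffOn_fderiv_apply hΩ H.smooth_U eu
  obtain ⟨δ₃, h3⟩ := exists_eq_const hΩ hc hXs fun z hz => by
    have hz' := H.smooth_X.contDiffAt (hΩ.mem_nhds hz)
    refine fderiv_fderiv_apply_eq_zero hΩ H.smooth_X hz ?_ (Xxx z hz) ?_
    · rw [fderiv_fderiv_comm hz', fderiv_fderiv_eq_zero hΩ H.smooth_X Xt hz]
    · rw [fderiv_fderiv_comm hz', fderiv_fderiv_eq_zero hΩ H.smooth_X Xu hz]
  obtain ⟨δ₅, h5⟩ := exists_eq_const hΩ hc hUs fun z hz => by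
    have hz' := H.smooth_U.contDiffAt (hΩ.mem_nhds hz)
    refine fderiv_fderiv_apply_eq_zero hΩ H.smooth_U hz ?_ ?_ (determining_equations H E hz).1
    · rw [fderiv_fderiv_comm hz', fderiv_fderiv_eq_zero hΩ H.smooth_U Ut hz]
    · rw [fderiv_fderiv_comm hz', fderiv_fderiv_eq_zero hΩ H.smooth_U Ux hz]
  have hTt : ∀ z ∈ Ω, fderiv ℝ T z et * (a' * δ₅ ^ (n - 1)) - δ₃ = 0 := fun z hz => by
    refine eq_zero_of_u_ne_zero (F := fun z => fderiv ℝ T z et * (a' * δ₅ ^ (n - 1)) - δ₃) hΩ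
      ((contDiffOn_fderiv_apply hΩ H.smooth_T et).mul contDiffOn_const
        |>.sub contDiffOn_const).continuousOn ?_ hz
    intro z hz hu
    have := coefficient_relation H A E hz hu
    rw [h5 z hz, h3 z hz] at this
    linear_combination this
  obtain ⟨z0, hz0⟩ := hc.nonempty
  have hδ₃ : δ₃ ≠ 0 := h3 z0 hz0 ▸ fderiv_X_ex_ne_zero H E hz0
  have hκ : a' * δ₅ ^ (n - 1) ≠ 0 := by
    intro h0
    have := hTt z0 hz0
    rw [h0] at this
    exact hδ₃ (by linarith)
  have h1 : ∀ z ∈ Ω, fderiv ℝ T z et = fderiv ℝ T z0 et := fun z hz =>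
    mul_right_cancel₀ hκ (by linear_combination hTt z hz - hTt z0 hz0)
  obtain ⟨δ₂, h2⟩ := exists_eq_add_const hΩ hc H.smooth_T (fderiv ℝ T z0) fun z hz => by
    rw [← sub_eq_zero]
    apply clm_eq_zero <;> simp only [sub_apply]
    · rw [h1 z hz, sub_self]
    · rw [(fderiv_T_eq_zero H E hz).1, (fderiv_T_eq_zero H E hz0).1, sub_self]
    · rw [(fderiv_T_eq_zero H E hz).2, (fderiv_T_eq_zero H E hz0).2, sub_self]
  obtain ⟨δ₄, h4⟩ := exists_eq_add_const hΩ hc H.smooth_X (fderiv ℝ X z0) fun z hz => by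
    rw [← sub_eq_zero]
    apply clm_eq_zero <;> simp only [sub_apply]
    · rw [Xt z hz, Xt z0 hz0, sub_self]
    · rw [h3 z hz, h3 z0 hz0, sub_self]
    · rw [Xu z hz, Xu z0 hz0, sub_self]
  refine ⟨fderiv ℝ T z0 et, δ₂, δ₃, δ₄, δ₅, ?_, fun z hz => ⟨?_, ?_, ?_, h1 z hz, h3 z hz,
    h5 z hz⟩⟩
  · exact mul_ne_zero (mul_ne_zero (fderiv_T_et_ne_zero H E hz0) hδ₃)
      (h5 z0 hz0 ▸ fderiv_U_eu_ne_zero H E hz0)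
  · have := h2 z hz
    rw [clm_apply_eq _ z.1 z.2.1 z.2.2, (fderiv_T_eq_zero H E hz0).1,
      (fderiv_T_eq_zero H E hz0).2] at this
    linear_combination this
  · have := h4 z hz
    rw [clm_apply_eq _ z.1 z.2.1 z.2.2, Xt z0 hz0, Xu z0 hz0, h3 z0 hz0] at this
    linear_combination this
  · have := eq_zero_of_u_ne_zero (F := fun z => U z - fderiv ℝ U z eu * z.2.2) hΩ
      (H.smooth_U.sub (hUs.mul (by fun_prop))).continuousOn
      (fun z hz hu => (scaling_form H A hz hu).1) hz
    simp only [h5 z hz] at this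
    linarith

end Global

/-! ### Every usual equivalence transformation is a scaling. -/

theorem rpow_mul_rpow_eq_one {b n : ℝ} (hb : b ≠ 0) (h : 0 < b ∨ ∃ k : ℤ, n = k) :
    b ^ (n - 1) * b ^ (1 - n) = 1 := by
  rcases h with h | ⟨k, rfl⟩
  · rw [← Real.rpow_add h]; simp
  · have h1 : ((k : ℝ) - 1) = ((k - 1 : ℤ) : ℝ) := by push_cast; rfl
    have h2 : (1 - (k : ℝ)) = ((1 - k : ℤ) : ℝ) := by push_cast; rfl
    rw [h1, h2, Real.rpow_intCast, Real.rpow_intCast, ← zpow_add₀ hb]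
    simp

/-- Differentiating `G ∘ F = id` shows that the differential of `F` is injective, hence surjective
in finite dimension. Any derivative of `G` within the image serves, so the image need not be known
to be open. -/
theorem surjective_fderiv_of_isDiffeoOn {E : Type*} [NormedAddCommGroup E] [NormedSpace ℝ E]
    [FiniteDimensional ℝ E] {F : E → E} {S : Set E} (hS : IsOpen S) (hF : IsDiffeoOn F S)
    {z : E} (hz : z ∈ S) : Function.Surjective (fderiv ℝ F z) := by
  obtain ⟨h1, G, hG, hGF⟩ := hF
  have d1 : HasFDerivAt F (fderiv ℝ F z) z :=
    ((h1.contDiffAt (hS.mem_nhds hz)).differentiableAt (by simp)).hasFDerivAt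
  have d2 := ((hG (F z) (mem_image_of_mem F hz)).differentiableWithinAt
    (by simp)).hasFDerivWithinAt
  have d3 := d2.comp z d1.hasFDerivWithinAt (mapsTo_image F S)
  have d4 : HasFDerivAt (G ∘ F) ((fderivWithin ℝ G (F '' S) (F z)).comp (fderiv ℝ F z)) z :=
    d3.hasFDerivAt (hS.mem_nhds hz)
  have d5 : HasFDerivAt (G ∘ F) (ContinuousLinearMap.id ℝ E) z := by
    refine (hasFDerivAt_id z).congr_of_eventuallyEq ?_
    filter_upwards [hS.mem_nhds hz] with y hy using hGF hy
  have e := d4.unique d5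
  have hinj : Function.Injective (fderiv ℝ F z : E →ₗ[ℝ] E) := by
    refine Function.LeftInverse.injective (g := fderivWithin ℝ G (F '' S) (F z)) fun v => ?_
    exact congrArg (fun L : E →L[ℝ] E => L v) e
  exact LinearMap.injective_iff_surjective.1 hinj

theorem nondegenerate_of_isDiffeoOn {Ω : Set Var} (hΩ : IsOpen Ω) {φ : Var → Var}
    (hφ : IsDiffeoOn φ Ω) :
    Nondegenerate Ω (fun z => (φ z).1) (fun z => (φ z).2.1) (fun z => (φ z).2.2) where
  isOpen := hΩ
  smooth_T := hφ.1.fst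
  smooth_X := hφ.1.snd.fst
  smooth_U := hφ.1.snd.snd
  surj := by
    intro z hz α β γ
    obtain ⟨w, hw⟩ := surjective_fderiv_of_isDiffeoOn hΩ hφ hz (α, β, γ)
    have d : HasFDerivAt φ (fderiv ℝ φ z) z :=
      ((hφ.1.contDiffAt (hΩ.mem_nhds hz)).differentiableAt (by simp)).hasFDerivAt
    refine ⟨w, ?_, ?_, ?_⟩
    · rw [d.fst.fderiv]; simp [hw]
    · rw [d.snd.fst.fderiv]; simp [hw]
    · rw [d.snd.snd.fderiv]; simp [hw]

theorem IsUsualEquivalence.exists_scaling {N : Set ℝ} (hN : N.Nonempty) (h0 : (0 : ℝ) ∉ N)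
    (h1 : (1 : ℝ) ∉ N) {Ω : Set Var} (hΩ : IsOpen Ω) (hΩc : IsConnected Ω)
    (hΩN : Ω ⊆ varDomain N) {Φ : Var × Elt → Var × Elt} (h : IsUsualEquivalence N Ω Φ) :
    ∃ δ₁ δ₂ δ₃ δ₄ δ₅ : ℝ, δ₁ * δ₃ * δ₅ ≠ 0 ∧
      (0 < δ₅ ∨ ∀ n ∈ N, ∃ k : ℤ, n = k) ∧
      ∀ t x u a n g : ℝ, (t, x, u) ∈ Ω → a ≠ 0 → n ∈ N → g ≠ 0 →
        Φ ((t, x, u), (a, n, g)) =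
          ((δ₁ * t + δ₂, δ₃ * x + δ₄, δ₅ * u),
            (δ₃ / δ₁ * δ₅ ^ (1 - n) * a, n, δ₃ ^ 2 / δ₁ * g)) := by
  obtain ⟨-, φ, hφ, hmap, hΦ, hcls⟩ := h
  have H := nondegenerate_of_isDiffeoOn hΩ hφ
  set T : Var → ℝ := fun z => (φ z).1
  set X : Var → ℝ := fun z => (φ z).2.1
  set U : Var → ℝ := fun z => (φ z).2.2
  have hE : ∀ n ∈ N, ∀ a g : ℝ, a ≠ 0 → g ≠ 0 → ∃ a' n' g',
      MapsConstEquation Ω T X U a n g a' n' g' ∧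
      ∀ z ∈ Ω, (Φ (z, (a, n, g))).2 = (a', n', g' (T z)) := by
    intro n hn a g ha hg
    obtain ⟨a', n', g', hc, hv, hm⟩ := hcls a n (fun _ => g)
      ⟨ha, hn, contDiffOn_const, fun _ _ => hg⟩
    refine ⟨a', n', g', ⟨ha, ?_, ?_, hg, hc.a_ne_zero, ?_, ?_, ?_, ?_, ?_, hm⟩, hv⟩
    · rintro rfl; exact h0 hn
    · rintro rfl; exact h1 hn
    · rintro rfl; exact h0 hc.n_mem
    · rintro rfl; exact h1 hc.n_mem
    · exact fun z hz => hc.g_ne_zero _ ⟨φ z, mem_image_of_mem φ hz, rfl⟩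
    · exact fun z hz => hΩN hz n hn
    · exact fun z hz => hmap hz n' hc.n_mem
  have hA : ∀ n ∈ N, MapsAllConst Ω T X U n := fun n hn a g ha hg => by
    obtain ⟨a', n', g', E, -⟩ := hE n hn a g ha hg
    exact ⟨a', n', g', E⟩
  obtain ⟨n0, hn0⟩ := hN
  obtain ⟨δ₁, δ₂, δ₃, δ₄, δ₅, hδ, hform⟩ := exists_scaling_form H hΩc (hA n0 hn0)
  have hδ₁ : δ₁ ≠ 0 := left_ne_zero_of_mul (left_ne_zero_of_mul hδ)
  have hδ₅ : δ₅ ≠ 0 := right_ne_zero_of_mul hδ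
  obtain ⟨z0, hz0⟩ := hΩc.nonempty
  have hsign : 0 < δ₅ ∨ ∀ n ∈ N, ∃ k : ℤ, n = k := by
    by_contra! hcon
    obtain ⟨hneg, n, hn, hnk⟩ := hcon
    -- For a non-integer exponent both `u` and `δ₅ u` must be positive, which excludes `δ₅ ≤ 0`.
    have hpos : ∀ u, PowDefined n u → 0 < u := by
      rintro u (h | ⟨-, k, hk⟩ | ⟨-, k, hk⟩)
      · exact h
      · exact absurd hk (hnk k)
      · exact absurd (by exact_mod_cast hk) (hnk k)
    have p1 := hpos _ (hΩN hz0 n hn)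
    have p2 := hpos _ (hmap hz0 n hn)
    have e : (φ z0).2.2 = δ₅ * z0.2.2 := (hform z0 hz0).2.2.1
    rw [e] at p2
    exact absurd (mul_nonpos_of_nonpos_of_nonneg hneg p1.le) (not_le.2 p2)
  -- The relations for `a'` and `n'` are available where `u ≠ 0`; as these are constants, one such
  -- point is enough.
  obtain ⟨z1, hz1, hu1⟩ : ∃ z ∈ Ω, z.2.2 ≠ 0 := by
    by_contra! hcon
    have := eq_zero_of_u_ne_zero (F := fun _ => (1 : ℝ)) hΩ continuousOn_const
      (fun z hz hu => absurd (hcon z hz) hu) hz0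
    exact one_ne_zero this
  refine ⟨δ₁, δ₂, δ₃, δ₄, δ₅, hδ, hsign, fun t x u a n g hz ha hn hg => ?_⟩
  obtain ⟨a', n', g', E, hv⟩ := hE n hn a g ha hg
  obtain ⟨fT, fX, fU, fTt, fXx, fUu⟩ := hform _ hz
  refine Prod.ext ?_ ?_
  · rw [hΦ _ hz _ ⟨ha, hn, hg⟩]
    exact Prod.ext fT (Prod.ext fX fU)
  · rw [hv _ hz]
    have r1 := coefficient_relation H (hA n hn) E hz1 hu1
    rw [(hform z1 hz1).2.2.2.1, (hform z1 hz1).2.2.2.2.1, (hform z1 hz1).2.2.2.2.2] at r1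
    have r2 := g_mul_fderiv_X_sq H E hz
    rw [fTt, fXx] at r2
    have r3 := rpow_mul_rpow_eq_one hδ₅ (hsign.imp id fun h => h n hn)
    refine Prod.ext ?_ (Prod.ext (power_consequences H (hA n hn) E hz1 hu1).1 ?_)
    · show a' = δ₃ / δ₁ * δ₅ ^ (1 - n) * a
      field_simp
      linear_combination δ₅ ^ (1 - n) * r1 - a' * δ₁ * r3
    · show g' (T (t, x, u)) = δ₃ ^ 2 / δ₁ * g
      field_simp
      linear_combination -r2

/-! ### Every scaling is a usual equivalence transformation. -/

/-- For negative `b` the real power is `exp (y log b) cos (π y)`, smooth in `y`. Thus for integer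
exponents and `δ₅ < 0` the formula for `a'` still extends smoothly in `n`. -/
theorem contDiff_const_rpow {b : ℝ} (hb : b ≠ 0) : ContDiff ℝ ∞ fun y : ℝ => b ^ y := by
  rcases lt_or_gt_of_ne hb with h | h
  · have : (fun y : ℝ => b ^ y) = fun y => Real.exp (Real.log b * y) * Real.cos (y * Real.pi) :=
      funext fun y => Real.rpow_def_of_neg h y
    rw [this]
    fun_prop
  · have : (fun y : ℝ => b ^ y) = fun y => Real.exp (Real.log b * y) :=
      funext fun y => Real.rpow_def_of_pos h y
    rw [this]
    fun_prop

theorem PowDefined.const_mul {n u δ : ℝ} (h : PowDefined n u) (hδ : δ ≠ 0)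
    (hs : 0 < δ ∨ ∃ k : ℤ, n = k) : PowDefined n (δ * u) := by
  rcases h with h | ⟨h, k, hk⟩ | ⟨h, hk⟩
  · rcases hs with hs | hk
    · exact .inl (mul_pos hs h)
    · rcases lt_or_gt_of_ne hδ with h' | h'
      · exact .inr (.inl ⟨mul_neg_of_neg_of_pos h' h, hk⟩)
      · exact .inl (mul_pos h' h)
  · rcases lt_or_gt_of_ne hδ with h' | h'
    · exact .inl (mul_pos_of_neg_of_neg h' h)
    · exact .inr (.inl ⟨mul_neg_of_pos_of_neg h' h, k, hk⟩)
  · exact .inr (.inr ⟨by rw [h, mul_zero], hk⟩)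

theorem deriv_comp_affine (k : ℝ → ℝ) (c d : ℝ) :
    deriv (fun s => k (c * s + d)) = fun s => c * deriv k (c * s + d) := by
  funext s
  have h1 := deriv_comp_mul_left c (fun r => k (r + d)) s
  rw [deriv_comp_add_const] at h1
  simpa using h1

theorem eventually_mul_rpow {n u δ : ℝ} (h : PowDefined n u) (hs : 0 < δ ∨ ∃ k : ℤ, n = k) :
    ∀ᶠ v in 𝓝 u, (δ * v) ^ n = δ ^ n * v ^ n := by
  have hint : (∃ k : ℤ, n = k) → ∀ᶠ v in 𝓝 u, (δ * v) ^ n = δ ^ n * v ^ n := by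
    rintro ⟨k, rfl⟩
    filter_upwards with v
    rw [Real.rpow_intCast, Real.rpow_intCast, Real.rpow_intCast, mul_zpow]
  rcases hs with hs | hk
  · rcases h with h | ⟨-, hk⟩ | ⟨-, k, hk⟩
    · filter_upwards [lt_mem_nhds h] with v hv
      exact Real.mul_rpow hs.le hv.le
    · exact hint hk
    · exact hint ⟨k, by exact_mod_cast hk⟩
  · exact hint hk

/-- The scaling and translation of the variables with parameters `δ₁, …, δ₅`. -/
def scaling (δ₁ δ₂ δ₃ δ₄ δ₅ : ℝ) (z : Var) : Var :=
  (δ₁ * z.1 + δ₂, δ₃ * z.2.1 + δ₄, δ₅ * z.2.2)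

theorem mapsEquation_scaling {Ω : Set Var} {δ₁ δ₂ δ₃ δ₄ δ₅ n : ℝ} (hδ₁ : δ₁ ≠ 0)
    (hδ₅ : δ₅ ≠ 0) (hs : 0 < δ₅ ∨ ∃ k : ℤ, n = k) (hpow : ∀ z ∈ Ω, PowDefined n z.2.2)
    (a : ℝ) (g : ℝ → ℝ) :
    MapsEquation Ω (scaling δ₁ δ₂ δ₃ δ₄ δ₅) a n g (δ₃ / δ₁ * δ₅ ^ (1 - n) * a) n
      (fun s => δ₃ ^ 2 / δ₁ * g ((s - δ₂) / δ₁)) := by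
  rintro f f' ⟨t, x⟩ hp hf - hcar
  have hbase : basePoint (scaling δ₁ δ₂ δ₃ δ₄ δ₅) f (t, x) = (δ₁ * t + δ₂, δ₃ * x + δ₄) := rfl
  have hcar' : ∀ᶠ q in 𝓝 (t, x), f' (δ₁ * q.1 + δ₂, δ₃ * q.2 + δ₄) = δ₅ * f q := hcar
  have ct : Tendsto (fun s : ℝ => (s, x)) (𝓝 t) (𝓝 (t, x)) := by
    have : Continuous fun s : ℝ => (s, x) := by fun_prop
    exact this.tendsto t
  have cx : Tendsto (fun s : ℝ => (t, s)) (𝓝 x) (𝓝 (t, x)) := by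
    have : Continuous fun s : ℝ => (t, s) := by fun_prop
    exact this.tendsto x
  have e1 : (fun s => f' (δ₁ * s + δ₂, δ₃ * x + δ₄)) =ᶠ[𝓝 t] fun s => δ₅ * f (s, x) :=
    ct.eventually hcar'
  have e2 : (fun s => f' (δ₁ * t + δ₂, δ₃ * s + δ₄)) =ᶠ[𝓝 x] fun s => δ₅ * f (t, s) :=
    cx.eventually hcar'
  have e3 : (fun s => f' (δ₁ * t + δ₂, δ₃ * s + δ₄) ^ n) =ᶠ[𝓝 x]
      fun s => δ₅ ^ n * f (t, s) ^ n := by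
    have := (hf.continuousAt.tendsto.comp cx).eventually (eventually_mul_rpow (hpow _ hp) hs)
    filter_upwards [e2, this] with s h1 h2
    rw [h1]
    exact h2
  have d1 := e1.deriv_eq
  have d2 := e2.deriv.deriv_eq
  have d3 := e3.deriv_eq
  rw [deriv_comp_affine (fun s => f' (s, δ₃ * x + δ₄)), deriv_const_mul_field] at d1
  rw [deriv_comp_affine (fun s => f' (δ₁ * t + δ₂, s)), deriv_const_mul_field,
    deriv_comp_affine (deriv fun s => f' (δ₁ * t + δ₂, s)), funext fun s =>
    deriv_const_mul_field (x := s) δ₅ (v := fun s => f (t, s)), deriv_const_mul_field] at d2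
  rw [deriv_comp_affine (fun s => f' (δ₁ * t + δ₂, s) ^ n), deriv_const_mul_field] at d3
  have hpw : δ₅ ^ (1 - n) * δ₅ ^ n = δ₅ := by
    have h1 := rpow_mul_rpow_eq_one hδ₅ hs
    rcases hs with h | ⟨k, rfl⟩
    · rw [← Real.rpow_add h]; simp
    · have h2 : (1 - (k : ℝ)) = ((1 - k : ℤ) : ℝ) := by push_cast; rfl
      rw [h2, Real.rpow_intCast, Real.rpow_intCast, ← zpow_add₀ hδ₅]
      simp
  rw [hbase]
  unfold SatisfiesAt
  simp only [iteratedDeriv_succ, iteratedDeriv_zero]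
  have hg : (δ₁ * t + δ₂ - δ₂) / δ₁ = t := by field_simp; ring
  rw [hg]
  beta_reduce at d1 d2 d3
  generalize deriv (fun s => f' (s, δ₃ * x + δ₄)) (δ₁ * t + δ₂) = ft' at *
  generalize deriv (fun s => f' (δ₁ * t + δ₂, s) ^ n) (δ₃ * x + δ₄) = P' at *
  generalize deriv (deriv fun s => f' (δ₁ * t + δ₂, s)) (δ₃ * x + δ₄) = fxx' at *
  generalize deriv (fun s => f (s, x)) t = ft at *
  generalize deriv (fun s => f (t, s) ^ n) x = P at *
  generalize deriv (deriv fun s => f (t, s)) x = fxx at *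
  -- The residuals of the two equations are proportional with nonzero factors, which gives both
  -- directions of the equivalence.
  have key : δ₁ * (ft' + δ₃ / δ₁ * δ₅ ^ (1 - n) * a * P' - δ₃ ^ 2 / δ₁ * g t * fxx') =
      δ₅ * (ft + a * P - g t * fxx) := by
    field_simp
    linear_combination d1 + δ₅ ^ (1 - n) * a * d3 - g t * d2 + a * P * hpw
  constructor
  · intro h
    rw [h, sub_self, mul_zero] at key
    linarith [(mul_eq_zero.1 key).resolve_left hδ₁]
  · intro h
    rw [h, sub_self, mul_zero] at key
    linarith [(mul_eq_zero.1 key.symm).resolve_left hδ₅]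

theorem isUsualEquivalence_of_scaling {N : Set ℝ} {Ω : Set Var} (hΩN : Ω ⊆ varDomain N)
    {Φ : Var × Elt → Var × Elt} {δ₁ δ₂ δ₃ δ₄ δ₅ : ℝ} (hδ : δ₁ * δ₃ * δ₅ ≠ 0)
    (hs : 0 < δ₅ ∨ ∀ n ∈ N, ∃ k : ℤ, n = k)
    (hΦ : ∀ t x u a n g : ℝ, (t, x, u) ∈ Ω → a ≠ 0 → n ∈ N → g ≠ 0 →
      Φ ((t, x, u), (a, n, g)) =
        ((δ₁ * t + δ₂, δ₃ * x + δ₄, δ₅ * u),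
          (δ₃ / δ₁ * δ₅ ^ (1 - n) * a, n, δ₃ ^ 2 / δ₁ * g))) :
    IsUsualEquivalence N Ω Φ := by
  have hδ₁ : δ₁ ≠ 0 := left_ne_zero_of_mul (left_ne_zero_of_mul hδ)
  have hδ₃ : δ₃ ≠ 0 := right_ne_zero_of_mul (left_ne_zero_of_mul hδ)
  have hδ₅ : δ₅ ≠ 0 := right_ne_zero_of_mul hδ
  have hs' : ∀ n ∈ N, 0 < δ₅ ∨ ∃ k : ℤ, n = k := fun n hn => hs.imp id fun h => h n hn
  have r1 := contDiff_const_rpow hδ₅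
  refine ⟨⟨?_, ?_⟩, scaling δ₁ δ₂ δ₃ δ₄ δ₅, ⟨?_, ?_⟩, ?_, ?_, ?_⟩
  · have h1 : ContDiff ℝ ∞ fun y : Var × Elt => δ₅ ^ (1 - y.2.2.1) :=
      r1.comp (g := fun y : ℝ => δ₅ ^ y) (f := fun y : Var × Elt => 1 - y.2.2.1) (by fun_prop)
    have h2 : ContDiff ℝ ∞ fun y : Var × Elt =>
        (((δ₁ * y.1.1 + δ₂, δ₃ * y.1.2.1 + δ₄, δ₅ * y.1.2.2),
          (δ₃ / δ₁ * δ₅ ^ (1 - y.2.2.1) * y.2.1, y.2.2.1, δ₃ ^ 2 / δ₁ * y.2.2.2)) : Var × Elt) := by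
      fun_prop
    refine h2.contDiffOn.congr ?_
    rintro ⟨⟨t, x, u⟩, a, n, g⟩ ⟨hz, ha, hn, hg⟩
    exact hΦ t x u a n g hz ha hn hg
  · have h1 : ContDiff ℝ ∞ fun y : Var × Elt => δ₅ ^ (y.2.2.1 - 1) :=
      r1.comp (g := fun y : ℝ => δ₅ ^ y) (f := fun y : Var × Elt => y.2.2.1 - 1) (by fun_prop)
    refine ⟨fun y => ((δ₁⁻¹ * (y.1.1 - δ₂), δ₃⁻¹ * (y.1.2.1 - δ₄), δ₅⁻¹ * y.1.2.2),
      (δ₁ * δ₃⁻¹ * δ₅ ^ (y.2.2.1 - 1) * y.2.1, y.2.2.1, δ₁ * (δ₃ ^ 2)⁻¹ * y.2.2.2)), ?_, ?_⟩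
    · refine ContDiff.contDiffOn ?_
      fun_prop
    · rintro ⟨⟨t, x, u⟩, a, n, g⟩ ⟨hz, ha, hn, hg⟩
      have r2 := rpow_mul_rpow_eq_one hδ₅ (hs' n hn)
      rw [hΦ t x u a n g hz ha hn hg]
      refine Prod.ext (Prod.ext ?_ (Prod.ext ?_ ?_)) (Prod.ext ?_ (Prod.ext rfl ?_)) <;> dsimp only
      · field_simp; ring
      · field_simp; ring
      · field_simp
      · have : δ₁ * δ₃⁻¹ * δ₅ ^ (n - 1) * (δ₃ / δ₁ * δ₅ ^ (1 - n) * a) =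
            (δ₅ ^ (n - 1) * δ₅ ^ (1 - n)) * a := by field_simp
        rw [this, r2, one_mul]
      · field_simp
  · refine ContDiff.contDiffOn ?_
    unfold scaling
    fun_prop
  · refine ⟨fun y => (δ₁⁻¹ * (y.1 - δ₂), δ₃⁻¹ * (y.2.1 - δ₄), δ₅⁻¹ * y.2.2),
      ContDiff.contDiffOn (by fun_prop), ?_⟩
    rintro ⟨t, x, u⟩ -
    refine Prod.ext ?_ (Prod.ext ?_ ?_) <;> simp [scaling, hδ₁, hδ₃, hδ₅]
  · exact fun z hz n hn => (hΩN hz n hn).const_mul hδ₅ (hs' n hn)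
  · rintro ⟨t, x, u⟩ hz ⟨a, n, g⟩ ⟨ha, hn, hg⟩
    rw [hΦ t x u a n g hz ha hn hg]
    rfl
  · intro a n g hc
    refine ⟨δ₃ / δ₁ * δ₅ ^ (1 - n) * a, n, fun s => δ₃ ^ 2 / δ₁ * g ((s - δ₂) / δ₁), ?_, ?_,
      mapsEquation_scaling hδ₁ hδ₅ (hs' n hc.n_mem) (fun z hz => hΩN hz n hc.n_mem) a g⟩
    · have hback : ∀ s ∈ times (scaling δ₁ δ₂ δ₃ δ₄ δ₅ '' Ω), (s - δ₂) / δ₁ ∈ times Ω := by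
        rintro _ ⟨_, ⟨z, hz, rfl⟩, rfl⟩
        refine ⟨z, hz, ?_⟩
        simp [scaling, hδ₁]
      refine ⟨?_, hc.n_mem, ?_, ?_⟩
      · exact mul_ne_zero (mul_ne_zero (div_ne_zero hδ₃ hδ₁)
          (right_ne_zero_of_mul_eq_one (rpow_mul_rpow_eq_one hδ₅ (hs' n hc.n_mem)))) hc.a_ne_zero
      · refine contDiffOn_const.mul (hc.g_smooth.comp (ContDiff.contDiffOn ?_) hback)
        fun_prop
      · exact fun s hs => mul_ne_zero (div_ne_zero (pow_ne_zero 2 hδ₃) hδ₁)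
          (hc.g_ne_zero _ (hback s hs))
    · rintro ⟨t, x, u⟩ hz
      rw [hΦ t x u a n _ hz hc.a_ne_zero hc.n_mem (hc.g_ne_zero t ⟨_, hz, rfl⟩)]
      simp [scaling, hδ₁]

end GenBurgers

theorem theorem1 (N : Set ℝ) (hN : N.Nonempty) (h0 : (0 : ℝ) ∉ N) (h1 : (1 : ℝ) ∉ N)
    (Ω : Set GenBurgers.Var) (hΩ : IsOpen Ω) (hΩc : IsConnected Ω)
    (hΩN : Ω ⊆ GenBurgers.varDomain N)
    (Φ : GenBurgers.Var × GenBurgers.Elt → GenBurgers.Var × GenBurgers.Elt) :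
    GenBurgers.IsUsualEquivalence N Ω Φ ↔
      ∃ δ₁ δ₂ δ₃ δ₄ δ₅ : ℝ, δ₁ * δ₃ * δ₅ ≠ 0 ∧
        (0 < δ₅ ∨ ∀ n ∈ N, ∃ k : ℤ, n = k) ∧
        ∀ t x u a n g : ℝ, (t, x, u) ∈ Ω → a ≠ 0 → n ∈ N → g ≠ 0 →
          Φ ((t, x, u), (a, n, g)) =
            ((δ₁ * t + δ₂, δ₃ * x + δ₄, δ₅ * u),
              (δ₃ / δ₁ * δ₅ ^ (1 - n) * a, n, δ₃ ^ 2 / δ₁ * g)) :=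
  ⟨fun h => h.exists_scaling hN h0 h1 hΩ hΩc hΩN,
    fun ⟨_, _, _, _, _, hδ, hs, hΦ⟩ => GenBurgers.isUsualEquivalence_of_scaling hΩN hδ hs hΦ⟩
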